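/- Let $C$ be a smooth projective geometrically irreducible curve over a field $k$. Fix $r\ge 0$, positive integers $\underline n=(n_0,\dots,n_r)$, real numbers $\underline\alpha=(\alpha_0,\dots,\alpha_r)$ with $\alpha_0<\alpha_1<\dots<\alpha_r$, and $d\in\mathbb Z$. For $\underline m\in\mathbb Z_{\ge 0}^{r+1}\setminus\{0\}$ and $\underline e\in\mathbb Z^{r+1}$ put $\mu_{\underline\alpha}(\underline m,\underline e)=\frac{\sum_i (e_i+\alpha_i m_i)}{\sum_i m_i}$. For $l\in[k,j]$, write $\underline m^{[k,j]\to l}$ for the vector obtained from $\underline m$ by replacing every entry $m_i$ with $k\le i\le j$ by $m_l$, and similarly for $\underline e$. For $\underline d\in\mathbb Z^{r+1}$ let $\mu_\bullet=\mu_{\underline\alpha}(\underline n,\underline d)$ and consider the conditions: 1. for all $0\le j\le r-1$: $\displaystyle\frac{\sum_{i=0}^j(d_i+\alpha_i n_i)}{\sum_{i=0}^j n_i}\le\mu_\bullet$; 2. for all $1\le j\le r$ with $n_j=n_{j-1}$: $\displaystyle\frac{d_j}{n_j}\le\frac{d_{j-1}}{n_{j-1}}$; 3. for all $0\le k<j\le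 r$ with $n_j<\min\{n_k,\dots,n_{j-1}\}$: $\mu_{\underline\alpha}(\underline n^{[k,j]\to j},\underline d^{[k,j]\to j})\le\mu_\bullet$; 4. for all $0\le k<j\le r$ with $n_k<\min\{n_{k+1},\dots,n_j\}$: $\mu_\bullet\le\mu_{\underline\alpha}(\underline n^{[k,j]\to k},\underline d^{[k,j]\to k})$. Then there are only finitely many $\underline d\in\mathbb Z^{r+1}$ with $\sum_i d_i=d$ which satisfy (1)–(4). The same holds if in (4) the requirement on $k<j$ is instead $n_j>\max\{n_k,\dots,n_{j-1}\}$. In particular, there are only finitely many $\underline d\in\mathbb Z^{r+1}$ with $\sum_i d_i=d$ such that the stack $\mathrm{Chain}_{\underline n}^{\underline d,\underline\alpha\text{-ss}}$ of $\underline\alpha$-semistable chains on $C$ of rank $\underline n$ and degree $\underline d$ is nonempty, i.e. such that for some field extension $K/k$ there is an $\underline\alpha$-semistable chain on $C_K$ of rank $\underline n$ and degree $\underline d$. Here a chain is a sequence $\mathcal E_r\to\mathcal E_{r-1}\to\dots\to\mathcal E_0$ of $\mathcal O$-linear maps of vector bundles $\mathcal E_i$ of rank $n_i$ and degree $d_i$;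 it is $\underline\alpha$-semistable if every nonzero subchain, of rank $\underline n'$ and degree $\underline d'$, satisfies $\mu_{\underline\alpha}(\underline n',\underline d')\le\mu_{\underline\alpha}(\underline n,\underline d)$. -/

import Mathlib

open CategoryTheory AlgebraicGeometry TopologicalSpace

universe u

noncomputable section

namespace HolomorphicChains

/-! ### Curves -/

/-- A smooth projective geometrically irreducible curve over a field `k`. (A proper curve over a
field is projective.) -/
class IsSmoothProjectiveCurve {k : Type u} [Field k] {C : Scheme.{u}}
    (f : C ⟶ Spec (.of k)) : Prop extends
    IsProper f, SmoothOfRelativeDimension 1 f, GeometricallyIrreducible f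

theorem isReduced_of_isStandardSmooth {R S : Type u} [CommRing R] [CommRing S] (hR : IsField R)
    (φ : R →+* S) (h : φ.IsStandardSmooth) : _root_.IsReduced S := by
  let := hR.toField
  obtain ⟨m, g, -, hg⟩ := h.exists_etale_mvPolynomial
  algebraize [g]
  let P := MvPolynomial (Fin m) R
  let K := FractionRing P
  have h1 : _root_.IsReduced (TensorProduct P K S) :=
    Algebra.FormallyUnramified.isReduced_of_field K (TensorProduct P K S)
  have hflat : Module.Flat P S := inferInstance
  have hinj : Function.Injective (Algebra.TensorProduct.includeRight : S →ₐ[P] TensorProduct P K S) :=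
    Algebra.TensorProduct.includeRight_injective (IsFractionRing.injective P K)
  exact isReduced_of_injective
    (Algebra.TensorProduct.includeRight : S →ₐ[P] TensorProduct P K S).toRingHom hinj

theorem isReduced_of_smooth {k : Type u} [Field k] {C : Scheme.{u}}
    (f : C ⟶ Spec (.of k)) [Smooth f] : AlgebraicGeometry.IsReduced C := by
  have : ∀ x : C, _root_.IsReduced (C.presheaf.stalk x) := by
    intro x
    obtain ⟨U, hU, V, hV, hxV, e, h⟩ := Smooth.exists_isStandardSmooth f x
    have hUtop : U = ⊤ := by
      ext y
      have hy : y = f x := Subsingleton.elim _ _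
      simpa [hy] using e hxV
    subst hUtop
    have hfield : IsField Γ(Spec (.of k), ⊤) :=
      (Scheme.ΓSpecIso (.of k)).commRingCatIsoToRingEquiv.toMulEquiv.isField (Field.toIsField k)
    have hred : _root_.IsReduced Γ(C, V) := isReduced_of_isStandardSmooth hfield _ h
    have := hV.isLocalization_stalk ⟨x, hxV⟩
    let := C.presheaf.algebra_section_stalk ⟨x, hxV⟩
    exact isReduced_localizationPreserves (hV.primeIdealOf ⟨x, hxV⟩).asIdeal.primeCompl
      (C.presheaf.stalk x) hred
  exact isReduced_of_isReduced_stalk C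

theorem isIntegral_of_curve {k : Type u} [Field k] {C : Scheme.{u}} (f : C ⟶ Spec (.of k))
    [IsSmoothProjectiveCurve f] : IsIntegral C := by
  have : Smooth f := SmoothOfRelativeDimension.smooth 1 f
  have := isReduced_of_smooth f
  have := GeometricallyIrreducible.irreducibleSpace_of_subsingleton f
  exact isIntegral_of_irreducibleSpace_of_isReduced C

theorem isLocallyNoetherian_of_curve {k : Type u} [Field k] {C : Scheme.{u}}
    (f : C ⟶ Spec (.of k)) [IsSmoothProjectiveCurve f] : IsLocallyNoetherian C :=
  LocallyOfFiniteType.isLocallyNoetherian f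

section

variable {k : Type u} [Field k] {C : Scheme.{u}} (f : C ⟶ Spec (.of k))
  [IsSmoothProjectiveCurve f]

/-- The base change `C_K` of a curve along a field extension `φ : k → K`. -/
abbrev baseChange {K : Type u} [Field K] (φ : k →+* K) : Scheme.{u} :=
  Limits.pullback f (Spec.map (CommRingCat.ofHom φ))

/-- The structure morphism `C_K → Spec K`. -/
abbrev baseChangeHom {K : Type u} [Field K] (φ : k →+* K) :
    baseChange f φ ⟶ Spec (.of K) :=
  Limits.pullback.snd f (Spec.map (CommRingCat.ofHom φ))

instance {K : Type u} [Field K] (φ : k →+* K) : IsSmoothProjectiveCurve (baseChangeHom f φ) where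
  toIsProper := inferInstance
  toSmoothOfRelativeDimension :=
    (smoothOfRelativeDimension_isStableUnderBaseChange 1).of_isPullback
      (IsPullback.of_hasPullback f (Spec.map (CommRingCat.ofHom φ))) inferInstance
  toGeometricallyIrreducible := inferInstance

end

/-! ### Locally free subsheaves, their rank and degree -/

/-- An `𝒪_X`-submodule sheaf of a sheaf of `𝒪_X`-modules `E`. -/
structure Subsheaf {X : Scheme.{u}} (E : X.Modules) where
  /-- the sections over an open set -/
  obj (U : X.Opens) : Submodule Γ(X, U) Γ(E, U)
  map_mem {U V : X.Opens} (i : V ≤ U) {s : Γ(E, U)} (hs : s ∈ obj U) :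
    E.presheaf.map (homOfLE i).op s ∈ obj V
  mem_of_locally_mem {U : X.Opens} (s : Γ(E, U))
    (hs : ∀ x ∈ U, ∃ (V : X.Opens) (i : V ≤ U), x ∈ V ∧ E.presheaf.map (homOfLE i).op s ∈ obj V) :
    s ∈ obj U

/-- `E` as a subsheaf of itself. -/
def Subsheaf.top {X : Scheme.{u}} (E : X.Modules) : Subsheaf E where
  obj _ := ⊤
  map_mem _ _ _ := trivial
  mem_of_locally_mem _ _ := trivial

/-- A frame of `F` over an open set `U`: sections `e_1, …, e_m` of `F` over `U` which induce an
isomorphism `𝒪_U^m ≅ F|_U`. -/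
structure LocalFrame {X : Scheme.{u}} {E : X.Modules} (F : Subsheaf E) (m : ℕ) where
  U : X.Opens
  sec : Fin m → Γ(E, U)
  mem : ∀ i, sec i ∈ F.obj U
  existsUnique_coord : ∀ (V : X.Opens) (i : V ≤ U), ∀ s ∈ F.obj V,
    ∃! a : Fin m → Γ(X, V), s = ∑ j, a j • E.presheaf.map (homOfLE i).op (sec j)

/-- `F` is a vector bundle of rank `m`: it is locally isomorphic to `𝒪_X^m`. -/
def IsVectorBundle {X : Scheme.{u}} {E : X.Modules} (F : Subsheaf E) (m : ℕ) : Prop :=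
  ∀ x : X, ∃ e : LocalFrame F m, x ∈ e.U

namespace LocalFrame

variable {X : Scheme.{u}} {E : X.Modules} {F : Subsheaf E} {m : ℕ}

/-- The coordinates of a section of `F` over `V ≤ e.U` with respect to the frame `e`. -/
def coord (e : LocalFrame F m) {V : X.Opens} (i : V ≤ e.U) (s : Γ(E, V)) (hs : s ∈ F.obj V) :
    Fin m → Γ(X, V) :=
  (e.existsUnique_coord V i s hs).choose

/-- The transition matrix `g` over `b.U ⊓ e.U` with `b_j = ∑ i, g i j • e_i`. -/
def transition (b e : LocalFrame F m) : Matrix (Fin m) (Fin m) Γ(X, b.U ⊓ e.U) :=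
  Matrix.of fun i j => e.coord inf_le_right
    (E.presheaf.map (homOfLE (inf_le_left : b.U ⊓ e.U ≤ b.U)).op (b.sec j))
    (F.map_mem inf_le_left (b.mem j)) i

end LocalFrame

theorem genericPoint_mem {X : Scheme.{u}} [IrreducibleSpace X] {U : X.Opens} {x : X}
    (hx : x ∈ U) : genericPoint X ∈ U :=
  ((genericPoint_spec X).mem_open_set_iff U.isOpen).mpr ⟨x, trivial, hx⟩

/-- The rational function `(b_1 ∧ ⋯ ∧ b_m) / (e_1 ∧ ⋯ ∧ e_m)` attached to two frames. -/
def LocalFrame.ratio {X : Scheme.{u}} [IrreducibleSpace X] {E : X.Modules} {F : Subsheaf E}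
    {m : ℕ} (b e : LocalFrame F m) (hb : genericPoint X ∈ b.U) (he : genericPoint X ∈ e.U) :
    X.functionField :=
  X.presheaf.germ (b.U ⊓ e.U) (genericPoint X) ⟨hb, he⟩ (b.transition e).det

/-- The vector bundle `F` of rank `m` has degree `d`: some nonzero rational section
`b_1 ∧ ⋯ ∧ b_m` of `det F` has a divisor of degree `d`. Here the order of `b_1 ∧ ⋯ ∧ b_m` at `x` is
the order of its quotient by a local generator `e_1 ∧ ⋯ ∧ e_m` of `det F` at `x`, and a point `x`
is counted with multiplicity `[κ(x) : k]`. The degree does not depend on the choices,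
as principal divisors on a complete curve have degree zero. -/
def HasDegree {k : Type u} [Field k] {C : Scheme.{u}} (f : C ⟶ Spec (.of k))
    [IsSmoothProjectiveCurve f] {E : C.Modules} (F : Subsheaf E) (m : ℕ) (d : ℤ) : Prop :=
  haveI := isIntegral_of_curve f
  haveI := isLocallyNoetherian_of_curve f
  ∃ (b : LocalFrame F m) (hb : genericPoint C ∈ b.U)
    (e : C → LocalFrame F m) (he : ∀ x, x ∈ (e x).U),
    d = ∑ᶠ x : C,
      Scheme.ord (b.ratio (e x) hb (genericPoint_mem (he x))) x * (f.residueDegree x : ℤ)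

/-! ### Chains, their type, slope and semistability -/

/-- A chain `E_r → E_{r-1} → ⋯ → E_0` of sheaves of modules on `X`. -/
structure Chain (X : Scheme.{u}) (r : ℕ) where
  sheaf : Fin (r + 1) → X.Modules
  map (i : Fin r) : sheaf i.succ ⟶ sheaf i.castSucc

/-- A subchain: subsheaves `F_i ⊆ E_i` respected by the maps of the chain. -/
structure Subchain {X : Scheme.{u}} {r : ℕ} (E : Chain X r) where
  sub (i : Fin (r + 1)) : Subsheaf (E.sheaf i)
  map_mem (i : Fin r) (U : X.Opens) (s : Γ(E.sheaf i.succ, U)) (hs : s ∈ (sub i.succ).obj U) :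
    (E.map i).app U s ∈ (sub i.castSucc).obj U

/-- A chain as a subchain of itself. -/
def Subchain.top {X : Scheme.{u}} {r : ℕ} (E : Chain X r) : Subchain E where
  sub i := Subsheaf.top (E.sheaf i)
  map_mem _ _ _ _ := trivial

/-- The `α`-slope `(∑ (d_i + α_i n_i)) / ∑ n_i` of rank `n` and degree `d`. -/
def slope {r : ℕ} (α : Fin (r + 1) → ℝ) (n : Fin (r + 1) → ℕ) (d : Fin (r + 1) → ℤ) : ℝ :=
  (∑ i, ((d i : ℝ) + α i * n i)) / ∑ i, (n i : ℝ)

section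

variable {k : Type u} [Field k] {C : Scheme.{u}} (f : C ⟶ Spec (.of k))
  [IsSmoothProjectiveCurve f] {r : ℕ}

/-- The members `F_i` of the subchain are vector bundles of rank `n_i` and degree `d_i`. -/
def Subchain.HasType {E : Chain C r} (F : Subchain E) (n : Fin (r + 1) → ℕ)
    (d : Fin (r + 1) → ℤ) : Prop :=
  ∀ i, IsVectorBundle (F.sub i) (n i) ∧ HasDegree f (F.sub i) (n i) (d i)

/-- The chain is a chain of vector bundles of rank `n` and degree `d`. -/
def Chain.HasType (E : Chain C r) (n : Fin (r + 1) → ℕ) (d : Fin (r + 1) → ℤ) : Prop :=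
  (Subchain.top E).HasType f n d

/-- The chain is an `α`-semistable chain of vector bundles of rank `n` and degree `d`: nonzero subchains
have at most the slope of the chain. (On a smooth curve, coherent subsheaves of
vector bundles are vector bundles.) -/
def Chain.IsSemistable (E : Chain C r) (n : Fin (r + 1) → ℕ) (d : Fin (r + 1) → ℤ)
    (α : Fin (r + 1) → ℝ) : Prop :=
  E.HasType f n d ∧
  ∀ (F : Subchain E) (n' : Fin (r + 1) → ℕ) (d' : Fin (r + 1) → ℤ), F.HasType f n' d' →
    (∃ i, n' i ≠ 0) → slope α n' d' ≤ slope α n d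

/-- The stack of `α`-semistable chains of rank `n` and degree `d` on `C` is nonempty: an algebraic
stack over `k` is nonempty exactly when it has a point with values in some extension field `K`
of `k`, and such a point is here an `α`-semistable chain on `C_K`. -/
def SemistableChainStackNonempty (n : Fin (r + 1) → ℕ) (d : Fin (r + 1) → ℤ)
    (α : Fin (r + 1) → ℝ) : Prop :=
  ∃ (K : Type u) (_ : Field K) (φ : k →+* K) (E : Chain (baseChange f φ) r),
    E.IsSemistable (baseChangeHom f φ) n d α

end

/-! ### The numerical conditions -/

/-- Replace the entries of `v` with index in `[k, j]` by the entry with index `l`. -/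
def replaceOn {r : ℕ} {A : Type*} (k j l : Fin (r + 1)) (v : Fin (r + 1) → A) : Fin (r + 1) → A :=
  fun i => if k ≤ i ∧ i ≤ j then v l else v i

/-- Conditions (1), (2) and (3). -/
structure ConditionsOneToThree {r : ℕ} (n : Fin (r + 1) → ℕ) (d : Fin (r + 1) → ℤ)
    (α : Fin (r + 1) → ℝ) : Prop where
  one : ∀ j : Fin r,
    (∑ i ∈ Finset.Iic j.castSucc, ((d i : ℝ) + α i * n i)) /
      ∑ i ∈ Finset.Iic j.castSucc, (n i : ℝ) ≤ slope α n d
  two : ∀ j : Fin r, n j.succ = n j.castSucc →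
    (d j.succ : ℝ) / n j.succ ≤ (d j.castSucc : ℝ) / n j.castSucc
  three : ∀ k j : Fin (r + 1), k < j → (∀ i, k ≤ i → i < j → n j < n i) →
    slope α (replaceOn k j j n) (replaceOn k j j d) ≤ slope α n d

/-- Conditions (1)-(4), where (4) is required for all `k < j` with
`n_k < min {n_{k+1}, …, n_j}`. -/
structure Conditions {r : ℕ} (n : Fin (r + 1) → ℕ) (d : Fin (r + 1) → ℤ)
    (α : Fin (r + 1) → ℝ) : Prop extends ConditionsOneToThree n d α where
  four : ∀ k j : Fin (r + 1), k < j → (∀ i, k < i → i ≤ j → n k < n i) →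
    slope α n d ≤ slope α (replaceOn k j k n) (replaceOn k j k d)

/-- Conditions (1)-(4), where (4) is required for all `k < j` with
`n_j > max {n_k, …, n_{j-1}}`. -/
structure Conditions' {r : ℕ} (n : Fin (r + 1) → ℕ) (d : Fin (r + 1) → ℤ)
    (α : Fin (r + 1) → ℝ) : Prop extends ConditionsOneToThree n d α where
  four : ∀ k j : Fin (r + 1), k < j → (∀ i, k ≤ i → i < j → n i < n j) →
    slope α n d ≤ slope α (replaceOn k j k n) (replaceOn k j k d)

end HolomorphicChains

end

namespace HolomorphicChains

/-! ### Local rings and closed subsets of curves -/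

/-! With `∑ i, d i` fixed, the slope of the whole chain is a constant `μ`. An upper bound on all
entries also bounds each from below, so upper bounds suffice (`finite_setOf_sum_eq_of_le`).

For the numerical conditions only adjacent indices matter. There (2), (3) or (4), according to how
`n_j` compares with `n_{j-1}`, bounds `d_j - d_{j-1}` above. Condition (1) bounds `d_0`, and
induction does the rest (`exists_forall_le_of_conditions`). The two versions of (4) agree for
adjacent indices.

For semistable chains the conditions are bypassed. Among nonzero locally free subsheaves of `E_i` of
slope at least `d_i / n_i`, let `F` have minimal rank. A nonzero kernel of smaller rank has smaller
slope, so each nonzero image of `F` in a vector bundle has slope at least `d_i / n_i`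
(`exists_subsheaf_forall_image`). The images of `F` under the composites `E_i → E_l` form a
subchain, and semistability gives `d_i / n_i + α_0 ≤ μ` (`div_add_le_slope_of_isSemistable`).

This needs kernels and images to be locally free with additive degree. The stalks are principal
ideal domains, so column reduction produces frames adapted to a map (`exists_adaptedFrame`). Their
transition matrices are block triangular, so determinants and orders split (`exists_hasDegree_add`).
Uniqueness of the degree is never needed. -/

theorem isPrincipalIdealRing_localization_of_isStandardSmooth {R S : Type u} [CommRing R]
    [CommRing S] (hR : IsField R) (φ : R →+* S) (h : φ.IsStandardSmoothOfRelativeDimension 1)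
    (q : Ideal S) [q.IsPrime] [IsDomain (Localization.AtPrime q)]
    [IsNoetherianRing (Localization.AtPrime q)] :
    IsPrincipalIdealRing (Localization.AtPrime q) := by
  let := hR.toField
  obtain ⟨g, -, hg⟩ := h.exists_etale_mvPolynomial
  algebraize [g]
  have hP : IsPrincipalIdealRing (MvPolynomial (Fin 1) R) :=
    IsPrincipalIdealRing.of_surjective
      (MvPolynomial.uniqueAlgEquiv R (Fin 1)).symm.toRingEquiv.toRingHom
      (MvPolynomial.uniqueAlgEquiv R (Fin 1)).symm.surjective
  let P := MvPolynomial (Fin 1) R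
  let p : Ideal P := q.under P
  have hlie : q.LiesOver p := ⟨rfl⟩
  let : Algebra (Localization.AtPrime p) (Localization.AtPrime q) :=
    Localization.AtPrime.algebraOfLiesOver p q
  -- Étale implies unramified, so the maximal ideal at `q` is extended from `p`, an ideal with one
  -- generator. A Noetherian local domain with principal maximal ideal is a principal ideal ring.
  have hmap := ((Algebra.isUnramifiedAt_iff_map_eq P p q).mp inferInstance).2
  have hprin : (IsLocalRing.maximalIdeal (Localization.AtPrime q)).IsPrincipal := by
    obtain ⟨a, ha⟩ := hP.principal p
    rw [← hmap, ha]
    refine ⟨algebraMap P _ a, ?_⟩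
    simp only [Ideal.submodule_span_eq, Ideal.map_span, Set.image_singleton]
  exact ((tfae_of_isNoetherianRing_of_isLocalRing_of_isDomain (Localization.AtPrime q)).out
    4 0).mp hprin

theorem isPrincipalIdealRing_stalk_of_curve {k : Type u} [Field k] {C : Scheme.{u}}
    (f : C ⟶ Spec (.of k)) [IsSmoothProjectiveCurve f] (x : C) :
    IsPrincipalIdealRing (C.presheaf.stalk x) := by
  have := isIntegral_of_curve f
  have := isLocallyNoetherian_of_curve f
  obtain ⟨U, hU, V, hV, hxV, e, h⟩ :=
    SmoothOfRelativeDimension.exists_isStandardSmoothOfRelativeDimension (n := 1) (f := f) x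
  have hUtop : U = ⊤ := by
    ext y
    have hy : y = f x := Subsingleton.elim _ _
    simpa [hy] using e hxV
  subst hUtop
  have hfield : IsField Γ(Spec (.of k), ⊤) :=
    (Scheme.ΓSpecIso (.of k)).commRingCatIsoToRingEquiv.toMulEquiv.isField (Field.toIsField k)
  let := C.presheaf.algebra_section_stalk ⟨x, hxV⟩
  let q := (hV.primeIdealOf ⟨x, hxV⟩).asIdeal
  have : IsLocalization.AtPrime (C.presheaf.stalk x) q := hV.isLocalization_stalk ⟨x, hxV⟩
  let E : C.presheaf.stalk x ≃+* Localization.AtPrime q :=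
    (IsLocalization.algEquiv q.primeCompl (C.presheaf.stalk x)
      (Localization.AtPrime q)).toRingEquiv
  have : IsDomain (Localization.AtPrime q) := E.symm.toMulEquiv.isDomain _
  have : IsNoetherianRing (Localization.AtPrime q) := isNoetherianRing_of_ringEquiv _ E
  have := isPrincipalIdealRing_localization_of_isStandardSmooth hfield _ h q
  exact IsPrincipalIdealRing.of_surjective E.symm.toRingHom E.symm.surjective

theorem coheight_le_one_of_curve {k : Type u} [Field k] {C : Scheme.{u}}
    (f : C ⟶ Spec (.of k)) [IsSmoothProjectiveCurve f] (x : C) : Order.coheight x ≤ 1 := by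
  have := isIntegral_of_curve f
  have := isPrincipalIdealRing_stalk_of_curve f x
  have h : ringKrullDim (C.presheaf.stalk x) ≤ 1 :=
    Ring.krullDimLE_iff.mp inferInstance
  rw [ringKrullDim_stalk_eq_coheight] at h
  exact_mod_cast h

/-- `Z` has finitely many irreducible components. The generic point of each lies strictly below that
of `C` in the specialization order, so a further proper specialization would have coheight at least
two: every component is a single point. -/
theorem finite_of_isClosed_of_genericPoint_notMem {k : Type u} [Field k] {C : Scheme.{u}}
    (f : C ⟶ Spec (.of k)) [IsSmoothProjectiveCurve f] {Z : Set C} (hZ : IsClosed Z)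
    (h : haveI := isIntegral_of_curve f; genericPoint C ∉ Z) : Z.Finite := by
  have := isIntegral_of_curve f
  have := isLocallyNoetherian_of_curve f
  have : CompactSpace C := QuasiCompact.compactSpace_of_compactSpace f
  have : IsNoetherian C := {}
  obtain ⟨S, hSfin, hS, hSi, rfl⟩ :=
    NoetherianSpace.exists_finite_set_isClosed_irreducible hZ
  refine hSfin.sUnion fun T hT ↦ Set.Subsingleton.finite ?_
  have hTc : IsClosed T := hS T hT
  have hTi : IsIrreducible T := hSi T hT
  obtain ⟨z, hz⟩ := QuasiSober.sober hTi hTc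
  have hzη : z < genericPoint C := by
    refine lt_of_le_not_ge le_top fun hle ↦ h ⟨T, hT, ?_⟩
    rw [← hz.def]
    exact specializes_iff_mem_closure.mp hle
  have key : ∀ w ∈ T, w = z := by
    intro w hw
    by_contra hne
    have hle : w ≤ z := specializes_iff_mem_closure.mpr (by rwa [hz.def])
    have hlt : w < z := lt_of_le_not_ge hle fun hge ↦ hne (Specializes.antisymm hge hle).eq
    have h1 := Order.coheight_add_one_le hlt
    have h2 := Order.coheight_add_one_le hzη
    have h3 := coheight_le_one_of_curve f w
    have h4 : (1 : ℕ∞) + 1 ≤ 1 :=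
      (add_le_add_left (le_trans le_add_self h2) 1).trans (h1.trans h3)
    exact absurd h4 (by decide)
  intro a ha b hb
  rw [key a ha, key b hb]

/-! ### Local frames as bases -/

section Restriction

variable {X : Scheme.{u}} (E : X.Modules)

theorem modules_map_map {U V W : X.Opens} (i : V ≤ U) (j : W ≤ V) (s : Γ(E, U)) :
    E.presheaf.map (homOfLE j).op (E.presheaf.map (homOfLE i).op s) =
      E.presheaf.map (homOfLE (j.trans i)).op s := by
  rw [← ConcreteCategory.comp_apply, ← Functor.map_comp]
  rfl

theorem modules_map_self {U : X.Opens} (i : U ≤ U) (s : Γ(E, U)) :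
    E.presheaf.map (homOfLE i).op s = s := by
  have : (homOfLE i).op = 𝟙 (Opposite.op U) := rfl
  rw [this, CategoryTheory.Functor.map_id]
  rfl

theorem modules_map_sum_smul {ι : Type*} (t : Finset ι) {U V : X.Opens} (i : V ≤ U)
    (a : ι → Γ(X, U)) (s : ι → Γ(E, U)) :
    E.presheaf.map (homOfLE i).op (∑ j ∈ t, a j • s j) =
      ∑ j ∈ t, X.presheaf.map (homOfLE i).op (a j) • E.presheaf.map (homOfLE i).op (s j) := by
  rw [map_sum]
  exact Finset.sum_congr rfl fun j _ ↦ E.map_smul _ _ _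

theorem app_map {E E' : X.Modules} (φ : E ⟶ E') {U V : X.Opens} (i : V ≤ U) (s : Γ(E, U)) :
    φ.app V (E.presheaf.map (homOfLE i).op s) =
      E'.presheaf.map (homOfLE i).op (φ.app U s) := by
  have := φ.mapPresheaf.naturality (homOfLE i).op
  exact ConcreteCategory.congr_hom this s

theorem app_sum_smul {E E' : X.Modules} (φ : E ⟶ E') {ι : Type*} (t : Finset ι) {U : X.Opens}
    (a : ι → Γ(X, U)) (s : ι → Γ(E, U)) :
    φ.app U (∑ j ∈ t, a j • s j) = ∑ j ∈ t, a j • φ.app U (s j) := by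
  rw [map_sum]
  exact Finset.sum_congr rfl fun j _ ↦ φ.app_smul _ _

end Restriction

namespace LocalFrame

variable {X : Scheme.{u}} {E : X.Modules} {F : Subsheaf E} {m : ℕ}

/-- A frame over `U` is a basis of the sections over each open subset of `U`. -/
noncomputable def basis (e : LocalFrame F m) {V : X.Opens} (i : V ≤ e.U) :
    Module.Basis (Fin m) Γ(X, V) (F.obj V) :=
  Module.Basis.mk
    (v := fun j ↦ (⟨E.presheaf.map (homOfLE i).op (e.sec j), F.map_mem i (e.mem j)⟩ : F.obj V))
    (by
      rw [Fintype.linearIndependent_iff]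
      intro a ha
      have h := (e.existsUnique_coord V i 0 (F.obj V).zero_mem).unique
        (y₁ := a) (y₂ := 0) (by simpa using (congrArg Subtype.val ha).symm) (by simp)
      exact fun j ↦ congrFun h j)
    (by
      rintro ⟨s, hs⟩ -
      obtain ⟨a, ha, -⟩ := e.existsUnique_coord V i s hs
      rw [Submodule.mem_span_range_iff_exists_fun]
      exact ⟨a, Subtype.ext (by simpa using ha.symm)⟩)

@[simp]
theorem coe_basis (e : LocalFrame F m) {V : X.Opens} (i : V ≤ e.U) (j : Fin m) :
    (e.basis i j : Γ(E, V)) = E.presheaf.map (homOfLE i).op (e.sec j) := by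
  simp [basis]

theorem sum_repr (e : LocalFrame F m) {V : X.Opens} (i : V ≤ e.U) {s : Γ(E, V)}
    (hs : s ∈ F.obj V) :
    s = ∑ j, (e.basis i).repr ⟨s, hs⟩ j • E.presheaf.map (homOfLE i).op (e.sec j) := by
  have h := congrArg Subtype.val ((e.basis i).sum_repr ⟨s, hs⟩)
  simp only [AddSubmonoidClass.coe_finsetSum, Submodule.coe_smul, coe_basis] at h
  exact h.symm

theorem repr_eq (e : LocalFrame F m) {V : X.Opens} (i : V ≤ e.U) {s : Γ(E, V)}
    (hs : s ∈ F.obj V) {a : Fin m → Γ(X, V)}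
    (h : s = ∑ j, a j • E.presheaf.map (homOfLE i).op (e.sec j)) :
    ⇑((e.basis i).repr ⟨s, hs⟩) = a :=
  (e.existsUnique_coord V i s hs).unique (e.sum_repr i hs) h

theorem coord_eq (e : LocalFrame F m) {V : X.Opens} (i : V ≤ e.U) (s : Γ(E, V))
    (hs : s ∈ F.obj V) : e.coord i s hs = (e.basis i).repr ⟨s, hs⟩ :=
  (e.repr_eq i hs (e.existsUnique_coord V i s hs).choose_spec.1).symm

theorem transition_eq (b e : LocalFrame F m) :
    b.transition e = (e.basis inf_le_right).toMatrix (b.basis inf_le_left) := by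
  ext i j
  rw [transition, Matrix.of_apply, coord_eq, Module.Basis.toMatrix_apply]
  congr 2
  exact Subtype.ext (by simp)

theorem repr_map (e : LocalFrame F m) {V W : X.Opens} (i : V ≤ e.U) (j : W ≤ V) {s : Γ(E, V)}
    (hs : s ∈ F.obj V) (l : Fin m) :
    (e.basis (j.trans i)).repr ⟨E.presheaf.map (homOfLE j).op s, F.map_mem j hs⟩ l =
      X.presheaf.map (homOfLE j).op ((e.basis i).repr ⟨s, hs⟩ l) := by
  refine congrFun (e.repr_eq (j.trans i) (F.map_mem j hs) (a := fun l ↦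
    X.presheaf.map (homOfLE j).op ((e.basis i).repr ⟨s, hs⟩ l)) ?_) l
  conv_lhs => rw [e.sum_repr i hs]
  rw [modules_map_sum_smul]
  simp_rw [modules_map_map]

theorem toMatrix_map {n : ℕ} (e : LocalFrame F m) (b : LocalFrame F n) {V W : X.Opens}
    (i : V ≤ e.U) (i' : V ≤ b.U) (j : W ≤ V) :
    (e.basis (j.trans i)).toMatrix (b.basis (j.trans i')) =
      ((e.basis i).toMatrix (b.basis i')).map (X.presheaf.map (homOfLE j).op).hom := by
  ext l l'
  rw [Matrix.map_apply, Module.Basis.toMatrix_apply, Module.Basis.toMatrix_apply]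
  refine Eq.trans ?_ (e.repr_map i j (b.basis i' l').2 l)
  congr 2
  exact Subtype.ext (by simp [modules_map_map])

theorem isUnit_det_toMatrix (b e : LocalFrame F m) {V : X.Opens} (ib : V ≤ b.U) (ie : V ≤ e.U) :
    IsUnit ((e.basis ie).toMatrix (b.basis ib)).det := by
  rw [← Module.Basis.det_apply]
  exact Module.Basis.isUnit_det _ _

section Ratio

variable [IrreducibleSpace X]

/-- Restriction commutes with determinants, so several ratios can be compared on one common open
set. -/
theorem ratio_eq (b e : LocalFrame F m) (hb : genericPoint X ∈ b.U) (he : genericPoint X ∈ e.U)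
    {V : X.Opens} (ib : V ≤ b.U) (ie : V ≤ e.U) (hV : genericPoint X ∈ V) :
    b.ratio e hb he =
      X.presheaf.germ V (genericPoint X) hV ((e.basis ie).toMatrix (b.basis ib)).det := by
  have h := toMatrix_map e b inf_le_right inf_le_left (le_inf ib ie)
  rw [ratio, transition_eq]
  change _ = X.presheaf.germ V (genericPoint X) hV
    ((e.basis ((le_inf ib ie).trans inf_le_right)).toMatrix
      (b.basis ((le_inf ib ie).trans inf_le_left))).det
  rw [h]
  change _ = X.presheaf.germ V (genericPoint X) hV (Matrix.det
    (RingHom.mapMatrix (X.presheaf.map (homOfLE (le_inf ib ie)).op).hom _))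
  rw [← RingHom.map_det]
  exact (X.presheaf.germ_res_apply (homOfLE (le_inf ib ie)) _ hV _).symm

theorem ratio_mul_ratio (b e c : LocalFrame F m) (hb : genericPoint X ∈ b.U)
    (he : genericPoint X ∈ e.U) (hc : genericPoint X ∈ c.U) :
    b.ratio e hb he * e.ratio c he hc = b.ratio c hb hc := by
  have hV : genericPoint X ∈ b.U ⊓ e.U ⊓ c.U := ⟨⟨hb, he⟩, hc⟩
  have ib : b.U ⊓ e.U ⊓ c.U ≤ b.U := inf_le_left.trans inf_le_left
  have ie : b.U ⊓ e.U ⊓ c.U ≤ e.U := inf_le_left.trans inf_le_right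
  rw [b.ratio_eq e hb he ib ie hV, e.ratio_eq c he hc ie inf_le_right hV,
    b.ratio_eq c hb hc ib inf_le_right hV, ← map_mul, mul_comm, ← Matrix.det_mul,
    Module.Basis.toMatrix_mul_toMatrix]

theorem ratio_self (b : LocalFrame F m) (hb : genericPoint X ∈ b.U) : b.ratio b hb hb = 1 := by
  rw [b.ratio_eq b hb hb le_rfl le_rfl hb, Module.Basis.toMatrix_self, Matrix.det_one, map_one]

theorem ratio_eq_one_of_size_eq_zero (b e : LocalFrame F m) (hm : m = 0)
    (hb : genericPoint X ∈ b.U) (he : genericPoint X ∈ e.U) : b.ratio e hb he = 1 := by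
  subst hm
  rw [ratio, Matrix.det_isEmpty, map_one]

theorem size_eq {n : ℕ} (b : LocalFrame F m) (e : LocalFrame F n) (hb : genericPoint X ∈ b.U)
    (he : genericPoint X ∈ e.U) : m = n := by
  have : Nonempty (b.U ⊓ e.U : X.Opens) := ⟨⟨genericPoint X, hb, he⟩⟩
  simpa using Fintype.card_congr ((b.basis (V := b.U ⊓ e.U) inf_le_left).indexEquiv
    (e.basis inf_le_right))

end Ratio

theorem ratio_ne_zero [IsIntegral X] (b e : LocalFrame F m) (hb : genericPoint X ∈ b.U)
    (he : genericPoint X ∈ e.U) : b.ratio e hb he ≠ 0 := by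
  intro h
  have h1 := b.ratio_mul_ratio e b hb he hb
  rw [h, zero_mul, ratio_self] at h1
  exact zero_ne_one h1

theorem ord_ratio_eq_zero [IsIntegral X] [IsLocallyNoetherian X] (b e : LocalFrame F m) {x : X}
    (hb : x ∈ b.U) (he : x ∈ e.U) :
    Scheme.ord (b.ratio e (genericPoint_mem hb) (genericPoint_mem he)) x = 0 := by
  have : Nonempty (b.U ⊓ e.U : X.Opens) := ⟨⟨x, hb, he⟩⟩
  rw [b.ratio_eq e _ _ (V := b.U ⊓ e.U) inf_le_left inf_le_right (genericPoint_mem ⟨hb, he⟩)]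
  exact Scheme.ord_of_isUnit (isUnit_det_toMatrix b e inf_le_left inf_le_right) ⟨hb, he⟩

/-- The order of `b_1 ∧ ⋯ ∧ b_m` at `x` does not depend on the frame at `x`. -/
theorem ord_ratio_congr [IsIntegral X] [IsLocallyNoetherian X] (b e e' : LocalFrame F m) {x : X}
    (hb : genericPoint X ∈ b.U) (he : x ∈ e.U) (he' : x ∈ e'.U) :
    Scheme.ord (b.ratio e hb (genericPoint_mem he)) x =
      Scheme.ord (b.ratio e' hb (genericPoint_mem he')) x := by
  rw [← b.ratio_mul_ratio e e' hb (genericPoint_mem he) (genericPoint_mem he'),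
    Scheme.ord_mul (ratio_ne_zero _ _ _ _) (ratio_ne_zero _ _ _ _), ord_ratio_eq_zero e e' he he',
    add_zero]

/-- The frame obtained from a frame over `V` by an invertible matrix `P`. -/
noncomputable def change (e : LocalFrame F m) {V : X.Opens} (i : V ≤ e.U)
    (P : Matrix (Fin m) (Fin m) Γ(X, V)) (hP : IsUnit P.det) : LocalFrame F m where
  U := V
  sec j := ∑ l, P l j • E.presheaf.map (homOfLE i).op (e.sec l)
  mem j := (F.obj V).sum_mem fun l _ ↦ (F.obj V).smul_mem _ (F.map_mem i (e.mem l))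
  existsUnique_coord W j s hs := by
    let Q := P.map (X.presheaf.map (homOfLE j).op).hom
    have hQ : IsUnit Q.det := by
      have : Q.det = (X.presheaf.map (homOfLE j).op).hom P.det :=
        (RingHom.map_det _ P).symm
      rw [this]
      exact hP.map _
    -- Coordinates `a` in the new frame become `Q a` in the old one, so inverting `Q` gives both
    -- existence and uniqueness.
    have key : ∀ a : Fin m → Γ(X, W), ∑ l, a l • E.presheaf.map (homOfLE j).op
        (∑ l', P l' l • E.presheaf.map (homOfLE i).op (e.sec l')) =
        ∑ l, (Q.mulVec a) l • E.presheaf.map (homOfLE (j.trans i)).op (e.sec l) := by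
      intro a
      simp_rw [modules_map_sum_smul, modules_map_map, Finset.smul_sum]
      rw [Finset.sum_comm]
      refine Finset.sum_congr rfl fun l _ ↦ ?_
      rw [Matrix.mulVec, dotProduct, Finset.sum_smul]
      refine Finset.sum_congr rfl fun l' _ ↦ ?_
      rw [smul_smul, mul_comm]
      rfl
    refine ⟨Q⁻¹.mulVec ((e.basis (j.trans i)).repr ⟨s, hs⟩), ?_, fun a ha ↦ ?_⟩
    · dsimp only
      rw [key, Matrix.mulVec_mulVec, Matrix.mul_nonsing_inv _ hQ, Matrix.one_mulVec]
      exact e.sum_repr _ hs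
    · dsimp only at ha
      rw [key] at ha
      rw [e.repr_eq _ hs ha, Matrix.mulVec_mulVec, Matrix.nonsing_inv_mul _ hQ, Matrix.one_mulVec]

theorem ratio_change [IrreducibleSpace X] (e : LocalFrame F m) {V : X.Opens} (i : V ≤ e.U)
    (P : Matrix (Fin m) (Fin m) Γ(X, V)) (hP : IsUnit P.det) (hV : genericPoint X ∈ V)
    (he : genericPoint X ∈ e.U) :
    (e.change i P hP).ratio e hV he = X.presheaf.germ V (genericPoint X) hV P.det := by
  refine (ratio_eq (e.change i P hP) e hV he (V := V) le_rfl i hV).trans ?_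
  have h : (e.basis i).toMatrix ((e.change i P hP).basis (V := V) le_rfl) = P := by
    ext l j
    refine congrFun (e.repr_eq (a := fun l ↦ P l j) i
      ((e.change i P hP).basis (V := V) le_rfl j).2 ?_) l
    exact ((e.change i P hP).coe_basis (V := V) le_rfl j).trans (modules_map_self E _ _)
  rw [h]

end LocalFrame

/-! ### Kernels and images of maps of subsheaves -/

theorem modules_eq_of_locally_eq {X : Scheme.{u}} (E : X.Modules) {U : X.Opens} (s t : Γ(E, U))
    (h : ∀ x ∈ U, ∃ (V : X.Opens) (i : V ≤ U), x ∈ V ∧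
      E.presheaf.map (homOfLE i).op s = E.presheaf.map (homOfLE i).op t) : s = t := by
  choose V i hV hst using h
  exact TopCat.Sheaf.eq_of_locally_eq' ⟨E.presheaf, E.isSheaf⟩ (fun x : U ↦ V x x.2) U
    (fun x ↦ homOfLE (i x x.2))
    (fun x hx ↦ Opens.mem_iSup.mpr ⟨⟨x, hx⟩, hV x hx⟩) s t (fun x ↦ hst x x.2)

namespace Subsheaf

variable {X : Scheme.{u}} {E E' : X.Modules}

/-- The kernel of a map on a subsheaf. -/
noncomputable def ker (φ : E ⟶ E') (F : Subsheaf E) : Subsheaf E where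
  obj U :=
    { carrier := {s | s ∈ F.obj U ∧ φ.app U s = 0}
      zero_mem' := ⟨(F.obj U).zero_mem, map_zero _⟩
      add_mem' := fun {s t} hs ht ↦
        ⟨(F.obj U).add_mem hs.1 ht.1, by rw [map_add, hs.2, ht.2, add_zero]⟩
      smul_mem' := fun c s hs ↦ ⟨(F.obj U).smul_mem c hs.1, by
        rw [Scheme.Modules.Hom.app_smul, hs.2, smul_zero]⟩ }
  map_mem i s hs := ⟨F.map_mem i hs.1, by rw [app_map, hs.2, map_zero]⟩
  mem_of_locally_mem s hs := by
    refine ⟨F.mem_of_locally_mem s fun x hx ↦ ?_, modules_eq_of_locally_eq E' _ _ fun x hx ↦ ?_⟩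
    · obtain ⟨V, i, hV, h⟩ := hs x hx
      exact ⟨V, i, hV, h.1⟩
    · obtain ⟨V, i, hV, h⟩ := hs x hx
      exact ⟨V, i, hV, by rw [← app_map, h.2, map_zero]⟩

/-- The image of a subsheaf, consisting of the sections which lift locally. -/
noncomputable def image (φ : E ⟶ E') (F : Subsheaf E) : Subsheaf E' where
  obj U :=
    { carrier := {t | ∀ x ∈ U, ∃ (V : X.Opens) (i : V ≤ U), x ∈ V ∧
        ∃ s ∈ F.obj V, φ.app V s = E'.presheaf.map (homOfLE i).op t}
      zero_mem' := fun x hx ↦ ⟨U, le_rfl, hx, 0, (F.obj U).zero_mem, by simp⟩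
      add_mem' := by
        intro s t hs ht x hx
        obtain ⟨V, i, hV, s', hs', h⟩ := hs x hx
        obtain ⟨W, j, hW, t', ht', h'⟩ := ht x hx
        refine ⟨V ⊓ W, inf_le_left.trans i, ⟨hV, hW⟩, _, (F.obj _).add_mem
          (F.map_mem inf_le_left hs') (F.map_mem inf_le_right ht'), ?_⟩
        rw [map_add, map_add, app_map, app_map, h, h', modules_map_map, modules_map_map]
      smul_mem' := by
        intro c t ht x hx
        obtain ⟨V, i, hV, s, hs, h⟩ := ht x hx
        refine ⟨V, i, hV, _, (F.obj V).smul_mem (X.presheaf.map (homOfLE i).op c) hs, ?_⟩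
        rw [Scheme.Modules.Hom.app_smul, h, Scheme.Modules.map_smul] }
  map_mem := by
    intro U V i t ht x hx
    obtain ⟨W, j, hW, s, hs, h⟩ := ht x (i hx)
    refine ⟨V ⊓ W, inf_le_left, ⟨hx, hW⟩, _, F.map_mem inf_le_right hs, ?_⟩
    rw [app_map, h, modules_map_map, modules_map_map]
  mem_of_locally_mem := by
    intro U t ht x hx
    obtain ⟨V, i, hV, h⟩ := ht x hx
    obtain ⟨W, j, hW, s, hs, h⟩ := h x hV
    exact ⟨W, j.trans i, hW, s, hs, by rw [h, modules_map_map]⟩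

theorem app_mem_image (φ : E ⟶ E') (F : Subsheaf E) {U : X.Opens} {s : Γ(E, U)}
    (hs : s ∈ F.obj U) : φ.app U s ∈ (F.image φ).obj U := fun _ hx ↦
  ⟨U, le_rfl, hx, s, hs, (modules_map_self _ _ _).symm⟩

theorem app_mem_image_comp {E'' : X.Modules} (φ : E ⟶ E') (ψ : E' ⟶ E'') (F : Subsheaf E)
    {U : X.Opens} {t : Γ(E', U)} (ht : t ∈ (F.image φ).obj U) :
    ψ.app U t ∈ (F.image (φ ≫ ψ)).obj U := fun x hx ↦ by
  obtain ⟨V, i, hV, s, hs, h⟩ := ht x hx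
  refine ⟨V, i, hV, s, hs, ?_⟩
  rw [← app_map, ← h]
  rfl

/-- A section that lifts locally along the identity lies locally in `F`, hence in `F`. This
identifies the `i`-th member of the subchain generated by a subsheaf of `E_i`. -/
theorem image_id (F : Subsheaf E) : F.image (𝟙 E) = F := by
  have h : ∀ U, (F.image (𝟙 E)).obj U = F.obj U := by
    refine fun U ↦ le_antisymm (fun t ht ↦ F.mem_of_locally_mem t fun x hx ↦ ?_)
      (fun t ht ↦ F.app_mem_image (𝟙 E) ht)
    obtain ⟨V, i, hV, s, hs, h⟩ := ht x hx
    refine ⟨V, i, hV, ?_⟩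
    rw [← h]
    exact hs
  obtain ⟨o, h1, h2⟩ := F
  generalize image (𝟙 E) ⟨o, h1, h2⟩ = G at h
  obtain ⟨o', h1', h2'⟩ := G
  obtain rfl : o' = o := funext h
  rfl

end Subsheaf

/-! ### Frames adapted to a map -/

/-- A frame of `F` whose first `a` members lie in the kernel of `φ`, and whose last `q` members have
linearly independent images. -/
structure AdaptedFrame {X : Scheme.{u}} {E E' : X.Modules} (φ : E ⟶ E') (F : Subsheaf E)
    (a q : ℕ) where
  frame : LocalFrame F (a + q)
  app_castAdd : ∀ i : Fin a, φ.app _ (frame.sec (Fin.castAdd q i)) = 0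
  eq_zero : ∀ (V : X.Opens) (i : V ≤ frame.U) (c : Fin q → Γ(X, V)),
    ∑ j, c j • φ.app V (E.presheaf.map (homOfLE i).op (frame.sec (Fin.natAdd a j))) = 0 → c = 0

namespace AdaptedFrame

variable {X : Scheme.{u}} {E E' : X.Modules} {φ : E ⟶ E'} {F : Subsheaf E} {a q : ℕ}

theorem app_sum (A : AdaptedFrame φ F a q) {V : X.Opens} (i : V ≤ A.frame.U)
    (c : Fin (a + q) → Γ(X, V)) :
    φ.app V (∑ l, c l • E.presheaf.map (homOfLE i).op (A.frame.sec l)) =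
      ∑ j, c (Fin.natAdd a j) •
        φ.app V (E.presheaf.map (homOfLE i).op (A.frame.sec (Fin.natAdd a j))) := by
  rw [app_sum_smul, Fin.sum_univ_add]
  simp only [app_map, A.app_castAdd, map_zero, smul_zero, Finset.sum_const_zero, zero_add]

/-- The frame of the kernel. -/
noncomputable def kerFrame (A : AdaptedFrame φ F a q) : LocalFrame (F.ker φ) a where
  U := A.frame.U
  sec i := A.frame.sec (Fin.castAdd q i)
  mem i := ⟨A.frame.mem _, A.app_castAdd i⟩
  existsUnique_coord V i s hs := by
    have h := A.frame.sum_repr i hs.1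
    set c := (A.frame.basis i).repr ⟨s, hs.1⟩ with hc
    have h0 : (fun j ↦ c (Fin.natAdd a j)) = 0 := by
      refine A.eq_zero V i _ ?_
      rw [← A.app_sum i (fun l ↦ c l), ← h, hs.2]
    refine ⟨fun l ↦ c (Fin.castAdd q l), ?_, fun b hb ↦ ?_⟩
    · dsimp only
      rw [h, Fin.sum_univ_add]
      simp [fun j ↦ congrFun h0 j]
    · have hb' := A.frame.repr_eq i hs.1 (a := Fin.append b 0) (by
        rw [Fin.sum_univ_add]
        simpa using hb)
      funext l
      rw [hc, hb', Fin.append_left]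

/-- The frame of the image. -/
noncomputable def imageFrame (A : AdaptedFrame φ F a q) : LocalFrame (F.image φ) q where
  U := A.frame.U
  sec j := φ.app _ (A.frame.sec (Fin.natAdd a j))
  mem j := F.app_mem_image φ (A.frame.mem _)
  existsUnique_coord V i t ht := by
    have huniq : ∀ (W : X.Opens) (j : W ≤ A.frame.U) (c c' : Fin q → Γ(X, W)),
        ∑ l, c l • E'.presheaf.map (homOfLE j).op (φ.app _ (A.frame.sec (Fin.natAdd a l))) =
        ∑ l, c' l • E'.presheaf.map (homOfLE j).op (φ.app _ (A.frame.sec (Fin.natAdd a l))) →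
        c = c' := by
      intro W j c c' h
      refine sub_eq_zero.mp (A.eq_zero W j (c - c') ?_)
      simp_rw [app_map, Pi.sub_apply, sub_smul, Finset.sum_sub_distrib]
      rw [h, sub_self]
    have hloc : ∀ x : V, ∃ (W : X.Opens) (j : W ≤ V) (c : Fin q → Γ(X, W)), x.1 ∈ W ∧
        E'.presheaf.map (homOfLE j).op t = ∑ l, c l •
          E'.presheaf.map (homOfLE (j.trans i)).op (φ.app _ (A.frame.sec (Fin.natAdd a l))) := by
      intro x
      obtain ⟨W, j, hW, s, hs, h⟩ := ht x x.2
      refine ⟨W, j, fun l ↦ (A.frame.basis (j.trans i)).repr ⟨s, hs⟩ (Fin.natAdd a l), hW, ?_⟩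
      rw [← h]
      conv_lhs => rw [A.frame.sum_repr (j.trans i) hs]
      rw [A.app_sum (j.trans i) (fun l ↦ (A.frame.basis (j.trans i)).repr ⟨s, hs⟩ l)]
      simp_rw [app_map]
    choose W j c hW hc using hloc
    -- Sections of the image lift only locally, so coordinates are first found locally; `huniq`
    -- makes them agree on overlaps.
    have hglue : ∀ l, ∃! b : Γ(X, V), ∀ x, X.presheaf.map (homOfLE (j x)).op b = c x l := by
      intro l
      refine TopCat.Sheaf.existsUnique_gluing' X.sheaf W V (fun x ↦ homOfLE (j x))
        (fun x hx ↦ Opens.mem_iSup.mpr ⟨⟨x, hx⟩, hW ⟨x, hx⟩⟩) (fun x ↦ c x l) ?_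
      intro x y
      have := huniq (W x ⊓ W y) (inf_le_left.trans ((j x).trans i))
        (fun l ↦ X.presheaf.map (homOfLE inf_le_left).op (c x l))
        (fun l ↦ X.presheaf.map (homOfLE inf_le_right).op (c y l)) ?_
      · exact congrFun this l
      · have hx := congrArg (E'.presheaf.map (homOfLE (inf_le_left : W x ⊓ W y ≤ W x)).op) (hc x)
        have hy := congrArg (E'.presheaf.map (homOfLE (inf_le_right : W x ⊓ W y ≤ W y)).op) (hc y)
        rw [modules_map_map, modules_map_sum_smul] at hx hy
        simp_rw [modules_map_map] at hx hy
        exact hx.symm.trans hy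
    choose b hb _ using hglue
    refine ⟨b, modules_eq_of_locally_eq E' _ _ fun x hx ↦
      ⟨W ⟨x, hx⟩, j _, hW _, ?_⟩, fun b' hb' ↦ ?_⟩
    · rw [hc, modules_map_sum_smul]
      simp_rw [modules_map_map, hb]
    · refine huniq V i b' b ?_
      rw [← hb']
      refine modules_eq_of_locally_eq E' _ _ fun x hx ↦ ⟨W ⟨x, hx⟩, j _, hW _, ?_⟩
      rw [hc, modules_map_sum_smul]
      simp_rw [modules_map_map, hb]

end AdaptedFrame

/-- Over a principal ideal domain, invertible column operations bring a matrix into the form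
`(0 | B)`, where `B` has linearly independent columns. -/
theorem exists_columns_zero_or_linearIndependent {R : Type*} [CommRing R] [IsDomain R]
    [IsPrincipalIdealRing R] {n m : ℕ} (A : Matrix (Fin n) (Fin m) R) :
    ∃ (a q : ℕ) (h : a + q = m) (P : Matrix (Fin m) (Fin m) R), IsUnit P.det ∧
      (∀ i : Fin a, (A * P).col (Fin.cast h (Fin.castAdd q i)) = 0) ∧
      LinearIndependent R fun j : Fin q ↦ (A * P).col (Fin.cast h (Fin.natAdd a j)) := by
  let φ := A.mulVecLin
  obtain ⟨a, ⟨bK⟩⟩ := Submodule.nonempty_basis_of_pid (Pi.basisFun R (Fin m)) (LinearMap.ker φ)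
  obtain ⟨q, ⟨bR⟩⟩ := Submodule.nonempty_basis_of_pid (Pi.basisFun R (Fin n)) (LinearMap.range φ)
  -- A basis of the kernel together with lifts of a basis of the range is a basis of `R^m`; `P` is
  -- its matrix.
  choose v hv using fun j ↦ (bR j).2
  let c : Fin (a + q) → Fin m → R := Fin.append (fun i ↦ (bK i : Fin m → R)) v
  have hcK (i) : c (Fin.castAdd q i) = bK i := Fin.append_left _ _ _
  have hcR (j) : c (Fin.natAdd a j) = v j := Fin.append_right _ _ _
  have hli : LinearIndependent R c := by
    rw [Fintype.linearIndependent_iff]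
    intro g hg
    rw [Fin.sum_univ_add] at hg
    simp only [hcK, hcR] at hg
    have hφ := congrArg φ hg
    rw [map_add, map_sum, map_sum, map_zero] at hφ
    have h1 : ∑ j, g (Fin.natAdd a j) • bR j = 0 := by
      refine Subtype.ext ?_
      simpa [hv] using hφ
    have h2 := Fintype.linearIndependent_iff.mp bR.linearIndependent _ h1
    have h3 : ∑ i, g (Fin.castAdd q i) • bK i = 0 := by
      refine Subtype.ext ?_
      simpa [h2] using hg
    have h4 := Fintype.linearIndependent_iff.mp bK.linearIndependent _ h3
    exact fun l ↦ Fin.addCases h4 h2 l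
  have hspan : ⊤ ≤ Submodule.span R (Set.range c) := by
    intro x _
    let r := bR.repr ⟨φ x, x, rfl⟩
    have hr : ∑ j, r j • φ (v j) = φ x := by
      have := congrArg Subtype.val (bR.sum_repr ⟨φ x, x, rfl⟩)
      simpa only [AddSubmonoidClass.coe_finsetSum, Submodule.coe_smul, hv] using this
    have hk : x - ∑ j, r j • v j ∈ LinearMap.ker φ := by
      rw [LinearMap.mem_ker, map_sub, map_sum]
      simp_rw [map_smul]
      rw [hr, sub_self]
    have hs := congrArg Subtype.val (bK.sum_repr ⟨_, hk⟩)
    simp only [AddSubmonoidClass.coe_finsetSum, Submodule.coe_smul] at hs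
    rw [← sub_add_cancel x (∑ j, r j • v j), ← hs]
    refine add_mem (sum_mem fun i _ ↦ Submodule.smul_mem _ _ (Submodule.subset_span ⟨_, hcK i⟩))
      (sum_mem fun j _ ↦ Submodule.smul_mem _ _ (Submodule.subset_span ⟨_, hcR j⟩))
  let b := Module.Basis.mk hli hspan
  have h : a + q = m := by simpa using Fintype.card_congr (b.indexEquiv (Pi.basisFun R (Fin m)))
  subst h
  refine ⟨a, q, rfl, (Pi.basisFun R _).toMatrix b, ?_, fun i ↦ ?_, ?_⟩
  · rw [← Module.Basis.det_apply]
    exact Module.Basis.isUnit_det _ _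
  all_goals
    have key : ∀ l, (A * (Pi.basisFun R _).toMatrix b).col l = φ (c l) := by
      intro l
      ext i
      simp [Matrix.mul_apply, Matrix.mulVec, dotProduct, Module.Basis.toMatrix_apply, b, φ]
  · rw [key, Fin.cast_eq_self, hcK]
    exact (bK i).2
  · simp only [key, Fin.cast_eq_self, hcR, hv]
    exact bR.linearIndependent.map' (Submodule.subtype _) (Submodule.ker_subtype _)

/-! ### Spreading out from a stalk to a neighbourhood -/

section

variable {X : Scheme.{u}}

theorem exists_germ_eq_of_finite {ι : Type*} [Finite ι] {U : X.Opens} {x : X} (hx : x ∈ U)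
    (s : ι → X.presheaf.stalk x) :
    ∃ (V : X.Opens) (_ : V ≤ U) (hV : x ∈ V) (t : ι → Γ(X, V)),
      ∀ i, X.presheaf.germ V x hV (t i) = s i := by
  have := Fintype.ofFinite ι
  choose W hW t ht using fun i ↦ X.presheaf.exists_germ_eq (s i)
  have hV : x ∈ U ⊓ Finset.univ.inf W := by
    refine ⟨hx, ?_⟩
    have : x ∈ ((Finset.univ.inf W : Opens X) : Set X) := by
      rw [Opens.coe_finset_inf]
      simpa using hW
    exact this
  have hle : ∀ i, U ⊓ Finset.univ.inf W ≤ W i := fun i ↦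
    inf_le_right.trans (Finset.inf_le (Finset.mem_univ i))
  refine ⟨_, inf_le_left, hV, fun i ↦ X.presheaf.map (homOfLE (hle i)).op (t i), fun i ↦ ?_⟩
  rw [← ht]
  exact X.presheaf.germ_res_apply (homOfLE (hle i)) x hV (t i)

/-- Finitely many germs extend to a common neighbourhood; passing to the locus where the determinant
is invertible makes the lifted matrix invertible. -/
theorem exists_isUnit_det_germ_eq {U : X.Opens} {x : X} (hx : x ∈ U) {m : ℕ}
    (P : Matrix (Fin m) (Fin m) (X.presheaf.stalk x)) (hP : IsUnit P.det) :
    ∃ (V : X.Opens) (_ : V ≤ U) (hV : x ∈ V) (Q : Matrix (Fin m) (Fin m) Γ(X, V)),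
      IsUnit Q.det ∧ Q.map (X.presheaf.germ V x hV).hom = P := by
  obtain ⟨V, i, hV, t, ht⟩ := exists_germ_eq_of_finite hx (fun l : Fin m × Fin m ↦ P l.1 l.2)
  let T : Matrix (Fin m) (Fin m) Γ(X, V) := Matrix.of fun i j ↦ t (i, j)
  have hT : T.map (X.presheaf.germ V x hV).hom = P := by
    ext i j
    exact ht (i, j)
  have hdet : IsUnit (X.presheaf.germ V x hV T.det) := by
    have : (X.presheaf.germ V x hV).hom T.det = P.det := by
      rw [← hT]
      exact RingHom.map_det _ T
    exact this ▸ hP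
  have hle := X.basicOpen_le T.det
  have hx' : x ∈ X.basicOpen T.det := (X.mem_basicOpen T.det x hV).mpr hdet
  refine ⟨X.basicOpen T.det, hle.trans i, hx', T.map (X.presheaf.map (homOfLE hle).op).hom, ?_, ?_⟩
  · have : (X.presheaf.map (homOfLE hle).op).hom T.det =
        (T.map (X.presheaf.map (homOfLE hle).op).hom).det := RingHom.map_det _ T
    rw [← this]
    exact RingedSpace.isUnit_res_basicOpen _ T.det
  · rw [← hT]
    ext l l'
    exact X.presheaf.germ_res_apply (homOfLE hle) x hx' (T l l')

variable {E E' : X.Modules} {F : Subsheaf E}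

/-- If the matrix of `φ` with respect to frames `e` and `w` over `V` has the form `(0 | B)`, where
`B` has linearly independent columns over the function field, then `e` is adapted to `φ`. -/
noncomputable def AdaptedFrame.ofMatrix [IsIntegral X] (φ : E ⟶ E') {a q n : ℕ}
    (e : LocalFrame F (a + q)) (w : LocalFrame (Subsheaf.top E') n) (i : e.U ≤ w.U)
    (hη : genericPoint X ∈ e.U) (B : Matrix (Fin n) (Fin (a + q)) Γ(X, e.U))
    (hB : ∀ l, φ.app _ (e.sec l) = ∑ t, B t l • E'.presheaf.map (homOfLE i).op (w.sec t))
    (h0 : ∀ l t, B t (Fin.castAdd q l) = 0)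
    (hli : LinearIndependent X.functionField fun (j : Fin q) (t : Fin n) ↦
      X.presheaf.germ e.U (genericPoint X) hη (B t (Fin.natAdd a j))) :
    AdaptedFrame φ F a q where
  frame := e
  app_castAdd l := by simp [hB, h0]
  eq_zero V j c hc := by
    by_cases hV : Nonempty V
    · have hηV : genericPoint X ∈ V := genericPoint_mem hV.some.2
      have h1 : ∀ t, ∑ l, c l * X.presheaf.map (homOfLE j).op (B t (Fin.natAdd a l)) = 0 := by
        have huniq := (w.existsUnique_coord V (j.trans i) 0 trivial).unique
          (y₁ := fun t ↦ ∑ l, c l * X.presheaf.map (homOfLE j).op (B t (Fin.natAdd a l)))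
          (y₂ := 0) ?_ (by simp)
        · exact fun t ↦ congrFun huniq t
        · rw [← hc]
          simp_rw [app_map, hB, modules_map_sum_smul, modules_map_map, Finset.smul_sum,
            Finset.sum_smul, mul_smul]
          exact Finset.sum_comm
      funext l
      refine germ_injective_of_isIntegral X (genericPoint X) hηV ?_
      rw [Pi.zero_apply, map_zero]
      refine Fintype.linearIndependent_iff.mp hli
        (fun l ↦ X.presheaf.germ V (genericPoint X) hηV (c l)) ?_ l
      funext t
      have h2 := congrArg (X.presheaf.germ V (genericPoint X) hηV) (h1 t)
      rw [map_sum, map_zero] at h2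
      rw [Finset.sum_apply, Pi.zero_apply, ← h2]
      refine Finset.sum_congr rfl fun l _ ↦ ?_
      rw [map_mul, Pi.smul_apply, smul_eq_mul]
      congr 1
      exact (X.presheaf.germ_res_apply (homOfLE j) _ hηV _).symm
    -- Over the empty set there is no generic point to test at, but the ring of sections is trivial.
    · have hbot : V = ⊥ := by
        ext y
        exact ⟨fun hy ↦ (hV ⟨⟨y, hy⟩⟩).elim, fun hy ↦ hy.elim⟩
      subst hbot
      exact Subsingleton.elim _ _

/-- The matrix of `φ` is column-reduced over the stalk at `x`, and the column operations spread out
to a change of frame near `x`. On an integral scheme germs are injective, so columns vanishing in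
the stalk vanish on the neighbourhood; independence passes from the stalk to its fraction field. -/
theorem exists_adaptedFrame [IsIntegral X] (φ : E ⟶ E') {m n : ℕ} {x : X}
    [IsPrincipalIdealRing (X.presheaf.stalk x)] (e : LocalFrame F m) (hxe : x ∈ e.U)
    (w : LocalFrame (Subsheaf.top E') n) (hxw : x ∈ w.U) :
    ∃ (a q : ℕ) (_ : a + q = m) (A : AdaptedFrame φ F a q), x ∈ A.frame.U := by
  have hx : x ∈ e.U ⊓ w.U := ⟨hxe, hxw⟩
  let A : Matrix (Fin n) (Fin m) Γ(X, e.U ⊓ w.U) := Matrix.of fun t l ↦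
    (w.basis inf_le_right).repr
      ⟨φ.app _ (E.presheaf.map (homOfLE inf_le_left).op (e.sec l)), trivial⟩ t
  have hA : ∀ l, φ.app _ (E.presheaf.map (homOfLE inf_le_left).op (e.sec l)) =
      ∑ t, A t l • E'.presheaf.map (homOfLE inf_le_right).op (w.sec t) := fun l ↦
    w.sum_repr inf_le_right trivial
  obtain ⟨a, q, rfl, P, hP, h0, hli⟩ := exists_columns_zero_or_linearIndependent
    (A.map (X.presheaf.germ (e.U ⊓ w.U) x hx).hom)
  obtain ⟨V, i, hV, Q, hQ, rfl⟩ := exists_isUnit_det_germ_eq hx P hP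
  have hη := genericPoint_mem hV
  let B := A.map (X.presheaf.map (homOfLE i).op).hom * Q
  have hBgerm : B.map (X.presheaf.germ V x hV).hom =
      A.map (X.presheaf.germ (e.U ⊓ w.U) x hx).hom * Q.map (X.presheaf.germ V x hV).hom := by
    rw [Matrix.map_mul, Matrix.map_map]
    congr 2
    ext t
    exact X.presheaf.germ_res_apply (homOfLE i) x hV _
  rw [← hBgerm] at h0 hli
  refine ⟨a, q, rfl, AdaptedFrame.ofMatrix φ (e.change (i.trans inf_le_left) Q hQ) w
    (i.trans inf_le_right) hη B (fun l ↦ ?_) (fun l t ↦ ?_) ?_, hV⟩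
  · change φ.app V (∑ l', Q l' l • E.presheaf.map (homOfLE (i.trans inf_le_left)).op (e.sec l')) =
      ∑ t, B t l • E'.presheaf.map (homOfLE (i.trans inf_le_right)).op (w.sec t)
    have h1 : ∀ l', φ.app V (E.presheaf.map (homOfLE (i.trans inf_le_left)).op (e.sec l')) =
        ∑ t, X.presheaf.map (homOfLE i).op (A t l') •
          E'.presheaf.map (homOfLE (i.trans inf_le_right)).op (w.sec t) := by
      intro l'
      have := congrArg (E'.presheaf.map (homOfLE i).op) (hA l')
      rw [← app_map, modules_map_map, modules_map_sum_smul] at this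
      simpa only [modules_map_map] using this
    rw [app_sum_smul]
    simp_rw [h1, Finset.smul_sum]
    rw [Finset.sum_comm]
    refine Finset.sum_congr rfl fun t _ ↦ ?_
    have hBl : B t l = ∑ l', X.presheaf.map (homOfLE i).op (A t l') * Q l' l := rfl
    rw [hBl, Finset.sum_smul]
    refine Finset.sum_congr rfl fun l' _ ↦ ?_
    rw [smul_smul, mul_comm]
  · refine germ_injective_of_isIntegral X x hV ?_
    exact (congrFun (h0 l) t).trans (map_zero _).symm
  · have h2 := hli.map' (Algebra.linearMap (X.presheaf.stalk x) X.functionField |>.compLeft (Fin n))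
      (by
        rw [LinearMap.ker_eq_bot]
        intro v v' h
        funext t
        exact IsFractionRing.injective (X.presheaf.stalk x) X.functionField (congrFun h t))
    rw [LinearIndependent.iff_fractionRing (X.presheaf.stalk x) X.functionField] at h2
    have : Nonempty V := ⟨⟨x, hV⟩⟩
    have h3 : (fun (j : Fin q) (t : Fin n) ↦
        X.presheaf.germ V (genericPoint X) hη (B t (Fin.natAdd a j))) = fun j t ↦
        algebraMap (X.presheaf.stalk x) X.functionField
          (X.presheaf.germ V x hV (B t (Fin.natAdd a j))) := by
      funext j t
      exact (Scheme.algebraMap_germ_eq_germToFunctionField X hV (B t (Fin.natAdd a j))).symm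
    exact h3 ▸ h2

end

namespace AdaptedFrame

variable {X : Scheme.{u}} {E E' : X.Modules} {φ : E ⟶ E'} {F : Subsheaf E} {a q : ℕ}

/-- The transition matrix of two adapted frames is block upper triangular, since kernel sections
have no components along the last `q` members. The diagonal blocks are the transition matrices of
kernel and image; the latter is `toMatrix_natAdd`. -/
theorem toMatrix_castAdd (b e : AdaptedFrame φ F a q) {V : X.Opens} (ib : V ≤ b.frame.U)
    (ie : V ≤ e.frame.U) (j : Fin a) :
    (fun l ↦ (e.frame.basis ie).toMatrix (b.frame.basis ib) l (Fin.castAdd q j)) =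
      Fin.append (fun i ↦ (e.kerFrame.basis (V := V) ie).toMatrix
        (b.kerFrame.basis (V := V) ib) i j) 0 := by
  refine e.frame.repr_eq ie (b.frame.basis ib (Fin.castAdd q j)).2 ?_
  have h := e.kerFrame.sum_repr (V := V) ie (b.kerFrame.basis (V := V) ib j).2
  have h' := b.kerFrame.coe_basis (V := V) ib j
  rw [Fin.sum_univ_add]
  simp only [Fin.append_left, Fin.append_right, Pi.zero_apply, zero_smul, Finset.sum_const_zero,
    add_zero]
  rw [LocalFrame.coe_basis]
  exact h'.symm.trans h

theorem toMatrix_natAdd (b e : AdaptedFrame φ F a q) {V : X.Opens} (ib : V ≤ b.frame.U)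
    (ie : V ≤ e.frame.U) (j : Fin q) :
    (fun i ↦ (e.imageFrame.basis (V := V) ie).toMatrix (b.imageFrame.basis (V := V) ib) i j) =
      fun i ↦ (e.frame.basis ie).toMatrix (b.frame.basis ib) (Fin.natAdd a i)
        (Fin.natAdd a j) := by
  refine e.imageFrame.repr_eq (V := V) ie (b.imageFrame.basis (V := V) ib j).2 ?_
  have h := congrArg (φ.app V)
    (e.frame.sum_repr ie (b.frame.basis ib (Fin.natAdd a j)).2)
  rw [e.app_sum ie (fun l ↦ (e.frame.basis ie).repr (b.frame.basis ib (Fin.natAdd a j)) l)] at h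
  simp only [LocalFrame.coe_basis, app_map] at h
  exact (b.imageFrame.coe_basis (V := V) ib j).trans h

/-- The form taken by `det F ≅ det (ker) ⊗ det (image)` at the generic point: the determinant of a
block triangular matrix. -/
theorem ratio_frame [IrreducibleSpace X] (b e : AdaptedFrame φ F a q)
    (hb : genericPoint X ∈ b.frame.U) (he : genericPoint X ∈ e.frame.U) :
    b.frame.ratio e.frame hb he =
      b.kerFrame.ratio e.kerFrame hb he * b.imageFrame.ratio e.imageFrame hb he := by
  have ib : b.frame.U ⊓ e.frame.U ≤ b.frame.U := inf_le_left
  have ie : b.frame.U ⊓ e.frame.U ≤ e.frame.U := inf_le_right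
  rw [b.frame.ratio_eq e.frame hb he ib ie ⟨hb, he⟩,
    b.kerFrame.ratio_eq e.kerFrame hb he ib ie ⟨hb, he⟩,
    b.imageFrame.ratio_eq e.imageFrame hb he ib ie ⟨hb, he⟩, ← map_mul]
  congr 1
  rw [← Matrix.det_fromBlocks_zero₂₁ _ (Matrix.of fun (i : Fin a) (j : Fin q) ↦
    (e.frame.basis ie).toMatrix (b.frame.basis ib) (Fin.castAdd q i) (Fin.natAdd a j)) _,
    ← Matrix.det_submatrix_equiv_self finSumFinEquiv]
  congr 1
  ext i j
  rcases i with i | i <;> rcases j with j | j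
  · have := congrFun (toMatrix_castAdd b e ib ie j) (Fin.castAdd q i)
    rw [Fin.append_left] at this
    simpa using this
  · simp
  · have := congrFun (toMatrix_castAdd b e ib ie j) (Fin.natAdd a i)
    rw [Fin.append_right] at this
    simpa using this
  · have := congrFun (toMatrix_natAdd b e ib ie j) i
    simpa using this.symm

theorem ord_ratio_frame [IsIntegral X] [IsLocallyNoetherian X] (b e : AdaptedFrame φ F a q)
    (hb : genericPoint X ∈ b.frame.U) (he : genericPoint X ∈ e.frame.U) (x : X) :
    Scheme.ord (b.frame.ratio e.frame hb he) x =
      Scheme.ord (b.kerFrame.ratio e.kerFrame hb he) x +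
        Scheme.ord (b.imageFrame.ratio e.imageFrame hb he) x :=
  (congrArg (Scheme.ord · x) (ratio_frame b e hb he)).trans
    (Scheme.ord_mul (LocalFrame.ratio_ne_zero _ _ _ _) (LocalFrame.ratio_ne_zero _ _ _ _))

/-- Rescaling an adapted frame by units. -/
noncomputable def scale (A : AdaptedFrame φ F a q) {V : X.Opens} (i : V ≤ A.frame.U)
    (v : Fin (a + q) → Γ(X, V)) (hv : ∀ l, IsUnit (v l)) : AdaptedFrame φ F a q :=
  have hsec : ∀ l, ∑ l', Matrix.diagonal v l' l •
      E.presheaf.map (homOfLE i).op (A.frame.sec l') =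
        v l • E.presheaf.map (homOfLE i).op (A.frame.sec l) := by
    intro l
    rw [Finset.sum_eq_single l]
    · rw [Matrix.diagonal_apply_eq]
    · intro l' _ h
      rw [Matrix.diagonal_apply_ne _ h, zero_smul]
    · simp
  { frame := A.frame.change i (Matrix.diagonal v) (by
      rw [Matrix.det_diagonal]
      exact IsUnit.prod_univ_iff.mpr hv)
    app_castAdd := by
      intro l
      change φ.app V (∑ l', Matrix.diagonal v l' _ •
        E.presheaf.map (homOfLE i).op (A.frame.sec l')) = 0
      rw [hsec, Scheme.Modules.Hom.app_smul, app_map, A.app_castAdd, map_zero, smul_zero]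
    eq_zero := by
      intro W (j : W ≤ V) c hc
      change ∑ l, c l • φ.app W (E.presheaf.map (homOfLE j).op
        (∑ l', Matrix.diagonal v l' _ • E.presheaf.map (homOfLE i).op (A.frame.sec l'))) = 0 at hc
      simp_rw [hsec, Scheme.Modules.map_smul, Scheme.Modules.Hom.app_smul, smul_smul,
        modules_map_map] at hc
      have h := A.eq_zero W (j.trans i) _ hc
      funext l
      have hu : IsUnit (X.presheaf.map (homOfLE j).op (v (Fin.natAdd a l))) :=
        (hv _).map (X.presheaf.map (homOfLE j).op).hom
      exact hu.mul_left_eq_zero.mp (congrFun h l) }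

/-- Normalizes an adapted frame so that its top wedge is that of a given frame `b`. The degree can
then be computed from the adapted frame without knowing that principal divisors have degree zero. -/
theorem exists_ratio_eq_one [IrreducibleSpace X] (A : AdaptedFrame φ F a q)
    (b : LocalFrame F (a + q)) (hA : genericPoint X ∈ A.frame.U) (hb : genericPoint X ∈ b.U) :
    ∃ (B : AdaptedFrame φ F a q) (hB : genericPoint X ∈ B.frame.U), B.frame.ratio b hB hb = 1 := by
  rcases Nat.eq_zero_or_pos (a + q) with h | h
  · exact ⟨A, hA, LocalFrame.ratio_eq_one_of_size_eq_zero _ _ h _ _⟩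
  · have iA : A.frame.U ⊓ b.U ≤ A.frame.U := inf_le_left
    have ib : A.frame.U ⊓ b.U ≤ b.U := inf_le_right
    let w := ((A.frame.basis iA).toMatrix (b.basis ib)).det
    have hw : IsUnit w := LocalFrame.isUnit_det_toMatrix b A.frame ib iA
    -- Rescaling one member by `w`, the ratio of `b` to `A.frame`, is enough. This needs a member to
    -- exist; in rank zero all ratios are `1`.
    let v : Fin (a + q) → Γ(X, A.frame.U ⊓ b.U) := Function.update 1 ⟨0, h⟩ w
    have hv : ∀ l, IsUnit (v l) := by
      intro l
      by_cases hl : l = ⟨0, h⟩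
      · subst hl
        simpa [v] using hw
      · simp [v, hl]
    have hdet : (Matrix.diagonal v).det = w := by
      rw [Matrix.det_diagonal, Finset.prod_update_of_mem (Finset.mem_univ _)]
      simp
    have hB : genericPoint X ∈ (A.scale iA v hv).frame.U :=
      show genericPoint X ∈ A.frame.U ⊓ b.U from ⟨hA, hb⟩
    refine ⟨A.scale iA v hv, hB, ?_⟩
    have h1 : (A.scale iA v hv).frame.ratio A.frame hB hA = b.ratio A.frame hb hA := by
      rw [b.ratio_eq A.frame hb hA ib iA ⟨hA, hb⟩]
      refine (A.frame.ratio_change iA _ (hdet ▸ hw) ⟨hA, hb⟩ hA).trans ?_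
      rw [hdet]
    rw [← LocalFrame.ratio_mul_ratio _ A.frame b hB hA hb, h1, LocalFrame.ratio_mul_ratio,
      LocalFrame.ratio_self]

end AdaptedFrame

/-- A map from a vector bundle to a vector bundle has a kernel and an image of
complementary ranks, and locally there are frames adapted to it. -/
theorem exists_forall_adaptedFrame {k : Type u} [Field k] {C : Scheme.{u}}
    (f : C ⟶ Spec (.of k)) [IsSmoothProjectiveCurve f] {E E' : C.Modules} (φ : E ⟶ E') {F : Subsheaf E} {m n : ℕ}
    (hF : IsVectorBundle F m) (hE' : IsVectorBundle (Subsheaf.top E') n) :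
    ∃ a q : ℕ, a + q = m ∧ ∀ x : C, ∃ A : AdaptedFrame φ F a q, x ∈ A.frame.U := by
  have := isIntegral_of_curve f
  have hloc : ∀ x : C, ∃ (a q : ℕ) (_ : a + q = m) (A : AdaptedFrame φ F a q),
      x ∈ A.frame.U := by
    intro x
    have := isPrincipalIdealRing_stalk_of_curve f x
    obtain ⟨e, he⟩ := hF x
    obtain ⟨w, hw⟩ := hE' x
    exact exists_adaptedFrame φ e he w hw
  -- The ranks `a` and `q` could depend on the point; all frames contain the generic point, so
  -- comparing there shows they are constant.
  obtain ⟨a, q, haq, A, hA⟩ := hloc (genericPoint C)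
  refine ⟨a, q, haq, fun x ↦ ?_⟩
  obtain ⟨a', q', -, A', hA'⟩ := hloc x
  obtain rfl := LocalFrame.size_eq A.kerFrame A'.kerFrame hA (genericPoint_mem hA')
  obtain rfl := LocalFrame.size_eq A.imageFrame A'.imageFrame hA (genericPoint_mem hA')
  exact ⟨A', hA'⟩

/-! ### Additivity of the degree -/

section Curve

variable {k : Type u} [Field k] {C : Scheme.{u}} (f : C ⟶ Spec (.of k))
  [IsSmoothProjectiveCurve f] {E E' : C.Modules}

theorem hasDegree_rank_zero {F : Subsheaf E} {d : ℤ} (h : HasDegree f F 0 d) : d = 0 := by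
  have := isIntegral_of_curve f
  have := isLocallyNoetherian_of_curve f
  obtain ⟨b, hb, e, he, hd⟩ := h
  rw [hd]
  refine finsum_eq_zero_of_forall_eq_zero fun x ↦ ?_
  have h1 := LocalFrame.ord_ratio_congr b (e x) b hb (he x)
  rw [LocalFrame.ratio_eq_one_of_size_eq_zero _ _ rfl,
    ← LocalFrame.ratio_self (e x) (genericPoint_mem (he x)),
    LocalFrame.ord_ratio_eq_zero _ _ (he x) (he x), zero_mul]

/-- The orders vanish on `b.U`, whose complement is finite. Finiteness is what allows the `finsum`
to be split. -/
theorem finite_support_ord {F : Subsheaf E} {m : ℕ} (b : LocalFrame F m)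
    (hb : haveI := isIntegral_of_curve f; genericPoint C ∈ b.U) (e : C → LocalFrame F m)
    (he : ∀ x, x ∈ (e x).U) (w : C → ℤ) :
    haveI := isIntegral_of_curve f
    haveI := isLocallyNoetherian_of_curve f
    (Function.support fun x ↦
      Scheme.ord (b.ratio (e x) hb (genericPoint_mem (he x))) x * w x).Finite := by
  have := isIntegral_of_curve f
  have := isLocallyNoetherian_of_curve f
  refine (finite_of_isClosed_of_genericPoint_notMem f (Z := (b.U : Set C)ᶜ)
    b.U.isOpen.isClosed_compl (fun h ↦ h hb)).subset fun x hx hxb ↦ hx ?_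
  dsimp only
  rw [LocalFrame.ord_ratio_eq_zero b (e x) hxb (he x), zero_mul]

/-- Additivity of the degree. -/
theorem exists_hasDegree_add {φ : E ⟶ E'} {F : Subsheaf E} {a q : ℕ}
    (hA : ∀ x : C, ∃ A : AdaptedFrame φ F a q, x ∈ A.frame.U) {d : ℤ}
    (hd : HasDegree f F (a + q) d) :
    ∃ d₁ d₂ : ℤ, d₁ + d₂ = d ∧ HasDegree f (F.ker φ) a d₁ ∧ HasDegree f (F.image φ) q d₂ := by
  have := isIntegral_of_curve f
  have := isLocallyNoetherian_of_curve f
  choose A hAx using hA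
  obtain ⟨b, hb, e, he, hd⟩ := hd
  obtain ⟨B, hB, hBb⟩ := (A (genericPoint C)).exists_ratio_eq_one b (hAx _) hb
  refine ⟨_, _, ?_, ⟨B.kerFrame, hB, fun x ↦ (A x).kerFrame, hAx, rfl⟩,
    ⟨B.imageFrame, hB, fun x ↦ (A x).imageFrame, hAx, rfl⟩⟩
  rw [hd, ← finsum_add_distrib
    (finite_support_ord f B.kerFrame hB (fun x ↦ (A x).kerFrame) hAx _)
    (finite_support_ord f B.imageFrame hB (fun x ↦ (A x).imageFrame) hAx _)]
  refine finsum_congr fun x ↦ ?_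
  rw [← add_mul]
  congr 1
  have h1 := LocalFrame.ratio_mul_ratio B.frame b (A x).frame hB hb (genericPoint_mem (hAx x))
  rw [hBb, one_mul] at h1
  rw [← LocalFrame.ord_ratio_congr b (A x).frame (e x) hb (hAx x) (he x), h1]
  exact (B.ord_ratio_frame (A x) hB (genericPoint_mem (hAx x)) x).symm

end Curve

/-! ### Degrees of semistable chains are bounded above -/

section Curve

variable {k : Type u} [Field k] {C : Scheme.{u}} (f : C ⟶ Spec (.of k))
  [IsSmoothProjectiveCurve f] {r : ℕ}

/-- A vector bundle `E` contains a nonzero vector bundle all of whose images in vector bundles have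
at least the slope of `E`. -/
theorem exists_subsheaf_forall_image {E : C.Modules} {n : ℕ} {d : ℤ} (hn : 0 < n)
    (hE : IsVectorBundle (Subsheaf.top E) n) (hd : HasDegree f (Subsheaf.top E) n d) :
    ∃ (F : Subsheaf E) (m : ℕ), 0 < m ∧ IsVectorBundle F m ∧
      ∀ {E' : C.Modules} (φ : E ⟶ E') {n' : ℕ}, IsVectorBundle (Subsheaf.top E') n' →
        ∃ (q : ℕ) (d' : ℤ), IsVectorBundle (F.image φ) q ∧ HasDegree f (F.image φ) q d' ∧
          (d / n : ℝ) * q ≤ d' := by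
  classical
  -- Ranks of nonzero locally free subsheaves of slope at least `d / n`; `F` realizes the least one,
  -- and `E` itself shows that there is one.
  let P : ℕ → Prop := fun m ↦ 0 < m ∧ ∃ F : Subsheaf E, IsVectorBundle F m ∧
    ∃ d' : ℤ, HasDegree f F m d' ∧ (d / n : ℝ) * m ≤ d'
  have hP : ∃ m, P m := by
    refine ⟨n, hn, Subsheaf.top E, hE, d, hd, le_of_eq ?_⟩
    have : (n : ℝ) ≠ 0 := by positivity
    field_simp
  obtain ⟨hm, F, hF, e, he, hle⟩ := Nat.find_spec hP
  have hmin : ∀ {a}, a < Nat.find hP → ¬ P a := fun h ↦ Nat.find_min hP h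
  set m := Nat.find hP
  refine ⟨F, m, hm, hF, fun φ n' hE' ↦ ?_⟩
  obtain ⟨a, q, haq, hA⟩ := exists_forall_adaptedFrame f φ hF hE'
  rw [← haq] at he
  obtain ⟨d₁, d₂, hadd, hd₁, hd₂⟩ := exists_hasDegree_add f hA he
  refine ⟨q, d₂, fun x ↦ ?_, hd₂, ?_⟩
  · obtain ⟨A, hx⟩ := hA x
    exact ⟨A.imageFrame, hx⟩
  rcases Nat.eq_zero_or_pos q with rfl | hq
  · rw [hasDegree_rank_zero f hd₂]
    simp
  -- Since `q > 0`, the kernel has rank below the minimum, so its slope is less than `d / n` unless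
  -- it is zero. The image must then make up for it.
  have h1 : (d₁ : ℝ) ≤ (d / n : ℝ) * a := by
    rcases Nat.eq_zero_or_pos a with rfl | ha
    · rw [hasDegree_rank_zero f hd₁]
      simp
    · by_contra! hlt
      refine hmin (a := a) (by omega) ⟨ha, F.ker φ, fun x ↦ ?_, d₁, hd₁, hlt.le⟩
      obtain ⟨A, hx⟩ := hA x
      exact ⟨A.kerFrame, hx⟩
  have h2 : (d₁ : ℝ) + d₂ = e := by exact_mod_cast hadd
  have h3 : (a : ℝ) + q = m := by exact_mod_cast haq
  rw [← h2, ← h3, mul_add] at hle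
  linarith

/-- The maps `E_i → E_l` of a chain, continued by zero to `l > i`. -/
theorem Chain.exists_composites {X : Scheme.{u}} (E : Chain X r) (i : Fin (r + 1)) :
    ∃ c : ∀ l, E.sheaf i ⟶ E.sheaf l, c i = 𝟙 _ ∧
      ∀ l : Fin r, c l.succ ≫ E.map l = c l.castSucc ∨ c l.succ = 0 := by
  classical
  let c : ∀ l, E.sheaf i ⟶ E.sheaf l := Fin.reverseInduction
    (motive := fun l ↦ E.sheaf i ⟶ E.sheaf l)
    (if h : i = Fin.last r then eqToHom (by rw [h]) else 0)
    (fun l g ↦ if h : i = l.castSucc then eqToHom (by rw [h]) else g ≫ E.map l)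
  have hlast : c (Fin.last r) = if h : i = Fin.last r then eqToHom (by rw [h]) else 0 :=
    Fin.reverseInduction_last ..
  have hcast (l : Fin r) : c l.castSucc =
      if h : i = l.castSucc then eqToHom (by rw [h]) else c l.succ ≫ E.map l :=
    Fin.reverseInduction_castSucc ..
  have hzero : ∀ l, i < l → c l = 0 := by
    intro l
    induction l using Fin.reverseInduction with
    | last =>
      intro h
      rw [hlast, dif_neg h.ne]
    | cast l ih =>
      intro h
      rw [hcast, dif_neg h.ne, ih (h.trans l.castSucc_lt_succ), Limits.zero_comp]
  refine ⟨c, ?_, fun l ↦ ?_⟩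
  · rcases Fin.eq_castSucc_or_eq_last i with ⟨l, h⟩ | h
    · subst h
      rw [hcast, dif_pos rfl, eqToHom_refl]
    · subst h
      rw [hlast, dif_pos rfl, eqToHom_refl]
  -- At target `i` the family restarts with the identity, so compatibility with the chain map fails
  -- there; but the preceding member is zero.
  · by_cases h : i = l.castSucc
    · exact Or.inr (hzero _ (h ▸ l.castSucc_lt_succ))
    · exact Or.inl (by rw [hcast, dif_neg h])

/-- The subchain of images of a minimal `F ⊆ E_i` has degree at least `(d_i / n_i) q_l` in each
place, and its weights are at least `β`; its slope is therefore at least the left-hand side. -/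
theorem div_add_le_slope_of_isSemistable {E : Chain C r} {n : Fin (r + 1) → ℕ}
    {d : Fin (r + 1) → ℤ} {α : Fin (r + 1) → ℝ} (hE : E.IsSemistable f n d α)
    (hn : ∀ i, 0 < n i) {β : ℝ} (hβ : ∀ i, β ≤ α i) (i : Fin (r + 1)) :
    (d i / n i : ℝ) + β ≤ slope α n d := by
  obtain ⟨hT, hss⟩ := hE
  obtain ⟨F, m, hm, hF, himg⟩ := exists_subsheaf_forall_image f (hn i) (hT i).1 (hT i).2
  obtain ⟨c, hci, hc⟩ := E.exists_composites i
  choose q d' hq hd' hle using fun l ↦ himg (c l) (hT l).1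
  let S : Subchain E :=
    { sub := fun l ↦ F.image (c l)
      map_mem := by
        intro l U s hs
        rcases hc l with h | h
        · rw [← h]
          exact Subsheaf.app_mem_image_comp _ _ F hs
        · have h0 : s = 0 := by
            refine modules_eq_of_locally_eq _ _ _ fun x hx ↦ ?_
            obtain ⟨V, j, hV, t, -, ht⟩ := hs x hx
            refine ⟨V, j, hV, ?_⟩
            rw [← ht, h, map_zero]
            rfl
          rw [h0, map_zero]
          exact Submodule.zero_mem _ }
  -- The `i`-th image is `F` itself, so the subchain is nonzero.
  have hqi : q i = m := by
    have h1 := hq i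
    rw [hci, Subsheaf.image_id] at h1
    have := isIntegral_of_curve f
    obtain ⟨e, he⟩ := h1 (genericPoint C)
    obtain ⟨e', he'⟩ := hF (genericPoint C)
    exact LocalFrame.size_eq e e' he he'
  refine le_trans ?_ (hss S q d' (fun l ↦ ⟨hq l, hd' l⟩) ⟨i, by omega⟩)
  have hpos : 0 < ∑ l, (q l : ℝ) :=
    Finset.sum_pos' (fun l _ ↦ Nat.cast_nonneg _)
      ⟨i, Finset.mem_univ _, by rw [hqi]; exact_mod_cast hm⟩
  rw [slope, le_div_iff₀ hpos, Finset.mul_sum]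
  refine Finset.sum_le_sum fun l _ ↦ ?_
  rw [add_mul]
  exact add_le_add (hle l) (mul_le_mul_of_nonneg_right (hβ l) (Nat.cast_nonneg _))

end Curve

/-! ### Finiteness -/

section Numerical

variable {r : ℕ}

theorem finite_setOf_sum_eq_of_le (d : ℤ) (B : ℝ) :
    {v : Fin (r + 1) → ℤ | ∑ i, v i = d ∧ ∀ i, (v i : ℝ) ≤ B}.Finite := by
  -- The other `r` entries are each at most `⌊B⌋`, which gives the lower bound.
  refine (Set.finite_Icc (fun _ : Fin (r + 1) ↦ d - r * ⌊B⌋) (fun _ ↦ ⌊B⌋)).subset ?_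
  rintro v ⟨hsum, hB⟩
  have hv : ∀ i, v i ≤ ⌊B⌋ := fun i ↦ Int.le_floor.mpr (hB i)
  refine ⟨fun i ↦ ?_, hv⟩
  have h := Finset.sum_le_card_nsmul (Finset.univ.erase i) v ⌊B⌋ fun j _ ↦ hv j
  rw [Finset.card_erase_of_mem (Finset.mem_univ i), Finset.card_univ, Fintype.card_fin,
    Nat.add_sub_cancel, nsmul_eq_mul] at h
  rw [← Finset.add_sum_erase _ _ (Finset.mem_univ i)] at hsum
  simp only
  linarith

theorem slope_eq (α : Fin (r + 1) → ℝ) (n : Fin (r + 1) → ℕ) (v : Fin (r + 1) → ℤ) :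
    slope α n v = ((∑ i, v i : ℤ) + ∑ i, α i * n i) / ∑ i, (n i : ℝ) := by
  rw [slope, Finset.sum_add_distrib, Int.cast_sum]

/-- For adjacent indices only one entry changes, so the replaced vector has sum `d + v_j - v_{j-1}`,
or the reverse difference in the companion lemma. -/
theorem replaceOn_castSucc_succ_succ {A : Type*} (j : Fin r) (v : Fin (r + 1) → A) :
    replaceOn j.castSucc j.succ j.succ v = Function.update v j.castSucc (v j.succ) := by
  funext i
  by_cases h : i = j.castSucc
  · subst h
    simp [replaceOn, j.castSucc_lt_succ.le]
  · by_cases h' : i = j.succ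
    · subst h'
      simp [replaceOn, Function.update_of_ne h]
    · rw [Function.update_of_ne h, replaceOn, if_neg]
      rw [Fin.ext_iff] at h h'
      simp only [Fin.le_def, Fin.val_castSucc, Fin.val_succ] at *
      omega

theorem replaceOn_castSucc_succ_castSucc {A : Type*} (j : Fin r) (v : Fin (r + 1) → A) :
    replaceOn j.castSucc j.succ j.castSucc v = Function.update v j.succ (v j.castSucc) := by
  funext i
  by_cases h : i = j.succ
  · subst h
    simp [replaceOn, j.castSucc_lt_succ.le]
  · by_cases h' : i = j.castSucc
    · subst h'
      simp [replaceOn, Function.update_of_ne h]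
    · rw [Function.update_of_ne h, replaceOn, if_neg]
      rw [Fin.ext_iff] at h h'
      simp only [Fin.le_def, Fin.val_castSucc, Fin.val_succ] at *
      omega

theorem sum_update {v : Fin (r + 1) → ℤ} {d : ℤ} (h : ∑ i, v i = d) (i : Fin (r + 1)) (x : ℤ) :
    ∑ l, Function.update v i x l = d + x - v i := by
  rw [Finset.sum_update_of_mem (Finset.mem_univ i), ← h,
    Finset.sdiff_singleton_eq_erase, ← Finset.add_sum_erase _ _ (Finset.mem_univ i)]
  ring

theorem sum_cast_pos {n : Fin (r + 1) → ℕ} (hn : ∀ i, 0 < n i) : 0 < ∑ i, (n i : ℝ) :=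
  Finset.sum_pos (fun i _ ↦ by exact_mod_cast hn i) Finset.univ_nonempty

theorem pos_update {n : Fin (r + 1) → ℕ} (hn : ∀ i, 0 < n i) (i j : Fin (r + 1)) :
    ∀ l, 0 < Function.update n i (n j) l := by
  intro l
  by_cases h : l = i
  · subst h
    simpa using hn j
  · simpa [h] using hn l

/-- Conditions (1)-(4) for `k = j - 1` bound `d` from above. -/
theorem exists_forall_le_of_conditions (n : Fin (r + 1) → ℕ) (hn : ∀ i, 0 < n i)
    (α : Fin (r + 1) → ℝ) (d : ℤ) :
    ∃ B : ℝ, ∀ v : Fin (r + 1) → ℤ, ∑ i, v i = d → ConditionsOneToThree n v α →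
      (∀ j : Fin r, n j.castSucc < n j.succ → slope α n v ≤
        slope α (replaceOn j.castSucc j.succ j.castSucc n)
          (replaceOn j.castSucc j.succ j.castSucc v)) →
      ∀ i, (v i : ℝ) ≤ B := by
  obtain ⟨μ, hμ⟩ : ∃ μ : ℝ, ∀ v : Fin (r + 1) → ℤ, ∑ i, v i = d → slope α n v = μ :=
    ⟨_, fun v hv ↦ by rw [slope_eq, hv]⟩
  have hstep : ∀ j : Fin r, ∃ K : ℝ, ∀ v : Fin (r + 1) → ℤ, ∑ i, v i = d →
      ConditionsOneToThree n v α →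
      (∀ j : Fin r, n j.castSucc < n j.succ → slope α n v ≤
        slope α (replaceOn j.castSucc j.succ j.castSucc n)
          (replaceOn j.castSucc j.succ j.castSucc v)) →
      (v j.succ : ℝ) ≤ v j.castSucc + K := by
    intro j
    -- Condition (3), (2) or (4) applies respectively. Each `K` is obtained by clearing the
    -- denominator and solving for the difference of the two entries.
    rcases lt_trichotomy (n j.succ) (n j.castSucc) with hlt | heq | hgt
    · refine ⟨μ * ∑ i, (Function.update n j.castSucc (n j.succ) i : ℝ) - d -
        ∑ i, α i * (Function.update n j.castSucc (n j.succ) i : ℝ), fun v hv h _ ↦ ?_⟩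
      have h3 := h.three j.castSucc j.succ j.castSucc_lt_succ fun i hi hi' ↦ by
        have : i = j.castSucc := by
          rw [Fin.ext_iff]
          simp only [Fin.le_def, Fin.lt_def, Fin.val_castSucc, Fin.val_succ] at *
          omega
        exact this ▸ hlt
      rw [hμ v hv, slope_eq, replaceOn_castSucc_succ_succ, replaceOn_castSucc_succ_succ,
        div_le_iff₀ (sum_cast_pos (pos_update hn _ _)), sum_update hv] at h3
      push_cast at h3
      linarith
    · refine ⟨0, fun v _ h _ ↦ ?_⟩
      have h2 := h.two j heq
      rw [heq, div_le_div_iff_of_pos_right (by exact_mod_cast hn _)] at h2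
      linarith
    · refine ⟨d + ∑ i, α i * (Function.update n j.succ (n j.castSucc) i : ℝ) -
        μ * ∑ i, (Function.update n j.succ (n j.castSucc) i : ℝ), fun v hv _ h4 ↦ ?_⟩
      have h4 := h4 j hgt
      rw [hμ v hv, slope_eq, replaceOn_castSucc_succ_castSucc, replaceOn_castSucc_succ_castSucc,
        le_div_iff₀ (sum_cast_pos (pos_update hn _ _)), sum_update hv] at h4
      push_cast at h4
      linarith
  choose K hK using hstep
  have hzero : ∃ B : ℝ, ∀ v : Fin (r + 1) → ℤ, ∑ i, v i = d → ConditionsOneToThree n v α →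
      (v 0 : ℝ) ≤ B := by
    -- Condition (1) is void for `r = 0`, but then `v 0 = d`; otherwise its case `j = 0` involves
    -- the single entry `v 0`.
    rcases r with _ | r
    · refine ⟨d, fun v hv _ ↦ ?_⟩
      simp only [Nat.reduceAdd, Finset.univ_unique, Fin.default_eq_zero, Fin.isValue,
        Finset.sum_singleton] at hv
      rw [hv]
    · refine ⟨μ * n 0 - α 0 * n 0, fun v hv h ↦ ?_⟩
      have h1 := h.one 0
      have hI : Finset.Iic ((0 : Fin (r + 1)).castSucc) = {0} := by
        ext i
        simp
      rw [hμ v hv, hI, Finset.sum_singleton, Finset.sum_singleton,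
        div_le_iff₀ (by exact_mod_cast hn 0)] at h1
      linarith
  obtain ⟨B, hB⟩ := hzero
  -- Each of the at most `r` steps from index `0` costs at most `∑ j, |K j|`, a crude bound that is
  -- uniform in the index.
  refine ⟨B + ∑ j, |K j| * (r + 1), fun v hv h h4 i ↦ ?_⟩
  rw [← Finset.sum_mul]
  have hKj : ∀ j, K j ≤ ∑ j, |K j| := fun j ↦ (le_abs_self _).trans
    (Finset.single_le_sum (f := fun j ↦ |K j|) (fun j _ ↦ abs_nonneg _) (Finset.mem_univ j))
  have h0 : 0 ≤ ∑ j, |K j| := Finset.sum_nonneg fun j _ ↦ abs_nonneg _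
  have hi : ∀ i : Fin (r + 1), (v i : ℝ) ≤ B + (∑ j, |K j|) * (i : ℕ) := by
    intro i
    induction i using Fin.induction with
    | zero => simpa using hB v hv h
    | succ i ih =>
      have := hK i v hv h h4
      rw [Fin.val_castSucc] at ih
      rw [Fin.val_succ]
      push_cast
      linarith [hKj i]
  refine (hi i).trans (add_le_add_right (mul_le_mul_of_nonneg_left ?_ h0) _)
  exact_mod_cast i.2.le

end Numerical

end HolomorphicChains

theorem mainTheorem6 {k : Type u} [Field k] {C : AlgebraicGeometry.Scheme.{u}}
    (f : C ⟶ AlgebraicGeometry.Spec (.of k)) [HolomorphicChains.IsSmoothProjectiveCurve f]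
    {r : ℕ} (n : Fin (r + 1) → ℕ) (hn : ∀ i, 0 < n i)
    (α : Fin (r + 1) → ℝ) (hα : StrictMono α) (d : ℤ) :
    {dv : Fin (r + 1) → ℤ | ∑ i, dv i = d ∧ HolomorphicChains.Conditions n dv α}.Finite ∧
    {dv : Fin (r + 1) → ℤ | ∑ i, dv i = d ∧ HolomorphicChains.Conditions' n dv α}.Finite ∧
    {dv : Fin (r + 1) → ℤ | ∑ i, dv i = d ∧
      HolomorphicChains.SemistableChainStackNonempty f n dv α}.Finite := by
  open HolomorphicChains in
  obtain ⟨B, hB⟩ := exists_forall_le_of_conditions n hn α d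
  refine ⟨?_, ?_, ?_⟩
  · refine (finite_setOf_sum_eq_of_le d B).subset fun v hv ↦ ⟨hv.1,
      hB v hv.1 hv.2.toConditionsOneToThree fun j hj ↦
        hv.2.four _ _ j.castSucc_lt_succ fun i hi hi' ↦ ?_⟩
    have : i = j.succ := by
      rw [Fin.ext_iff]
      simp only [Fin.le_def, Fin.lt_def, Fin.val_castSucc, Fin.val_succ] at *
      omega
    exact this ▸ hj
  · refine (finite_setOf_sum_eq_of_le d B).subset fun v hv ↦ ⟨hv.1,
      hB v hv.1 hv.2.toConditionsOneToThree fun j hj ↦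
        hv.2.four _ _ j.castSucc_lt_succ fun i hi hi' ↦ ?_⟩
    have : i = j.castSucc := by
      rw [Fin.ext_iff]
      simp only [Fin.le_def, Fin.lt_def, Fin.val_castSucc, Fin.val_succ] at *
      omega
    exact this ▸ hj
  · obtain ⟨μ, hμ⟩ : ∃ μ : ℝ, ∀ v : Fin (r + 1) → ℤ, ∑ i, v i = d → slope α n v = μ :=
      ⟨_, fun v hv ↦ by rw [slope_eq, hv]⟩
    -- Semistability gives `v i ≤ (μ - α 0) * n i`; the bound used depends neither on `i` nor on the
    -- field `K` or the chain.
    refine (finite_setOf_sum_eq_of_le d (|μ - α 0| * ∑ i, (n i : ℝ))).subset ?_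
    rintro v ⟨hv, K, _, φ, E, hE⟩
    refine ⟨hv, fun i ↦ ?_⟩
    have h := div_add_le_slope_of_isSemistable (baseChangeHom f φ) hE hn
      (fun i ↦ hα.monotone (Fin.zero_le i)) i
    have hni : (0 : ℝ) < n i := by exact_mod_cast hn i
    rw [hμ v hv, ← le_sub_iff_add_le, div_le_iff₀ hni] at h
    refine h.trans (mul_le_mul (le_abs_self _) ?_ hni.le (abs_nonneg _))
    exact Finset.single_le_sum (f := fun i ↦ (n i : ℝ)) (fun i _ ↦ Nat.cast_nonneg _)
      (Finset.mem_univ i)
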